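/- Setting. Let $N\in\{2,3\}$, let $\Omega\subset\mathbb R^N$ be open and bounded with $C^{1,1}$-boundary $\Gamma$, let $0<T<\infty$, $\Omega_T=\Omega\times(0,T)$, $\Sigma_T=\Gamma\times(0,T)$, $r>N/2+1$, $s>N+1$ ($r=\infty$, $s=\infty$ allowed), with conjugate exponents $r',s'$, and let $\alpha,\beta>0$. Let $a_{ij}=a_{ji}\in L^\infty(\Omega)$ be uniformly elliptic, $Ay=-\sum_{i,j}\partial_{x_j}(a_{ij}\partial_{x_i}y)$ with co-normal derivative $\partial_{\nu_A}$. Let $y_0\in C(\overline\Omega)$, $y_d\in L^2(\Omega)$, $\psi\in C(\overline\Omega_T)$, $u_a<u_b$ in $L^r(\Omega_T)$, $v_a<v_b$ in $L^s(\Sigma_T)$, and $$U_{ad}=\{u\in L^r(\Omega_T): u_a\le u\le u_b \text{ a.e.}\},\qquad V_{ad}=\{v\in L^s(\Sigma_T): v_a\le v\le v_b\text{ a.e.}\}.$$ Let $W(0,T)=\{y\in L^2(0,T;H^1(\Omega)): y_t\in L^2(0,T;H^1(\Omega)^*)\}$. For $f\in L^r(\Omega_T)$, $g\in L^s(\Sigma_T)$,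 a function $y\in W(0,T)\cap C(\overline\Omega_T)$ is the weak solution of $y_t+Ay=f$ in $\Omega_T$, $\partial_{\nu_A}y=g$ on $\Sigma_T$, $y(\cdot,0)=\eta$ if $y(\cdot,0)=\eta$ on $\overline\Omega$ and, for all $w\in L^2(0,T;H^1(\Omega))$, $$\int_0^T\langle y_t,w\rangle dt+\int_{\Omega_T}\sum_{i,j}a_{ij}\,\partial_{x_i}y\,\partial_{x_j}w\,dx\,dt=\int_{\Omega_T}fw\,dx\,dt+\int_{\Sigma_T}gw\,dS\,dt .$$ Optimality system of the state-constrained problem. Let $\bar u\in U_{ad}$, $\bar v\in V_{ad}$; let $\bar y\in W(0,T)\cap C(\overline\Omega_T)$ be the weak solution of $\bar y_t+A\bar y=\bar u$, $\partial_{\nu_A}\bar y=\bar v$, $\bar y(\cdot,0)=y_0$, with $\bar y\le\psi$ in $\Omega_T$; let $\bar\mu=\mu_{\Omega_T}+\mu_{\Sigma_T}\ge0$ be a finite Borel measure with $\mu_{\Omega_T}$ concentrated on $\Omega_T$ and $\mu_{\Sigma_T}$ on $\Sigma_T$; let $\bar p\in L^1(0,T;W^{1,q}(\Omega))$ for some $q\in(1,\tfrac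 N{N-1})$, with $\bar p\in L^{r'}(\Omega_T)$ and trace $\bar p|_{\Sigma_T}\in L^{s'}(\Sigma_T)$, solve $-\bar p_t+A\bar p=\mu_{\Omega_T}$ in $\Omega_T$, $\partial_{\nu_A}\bar p=\mu_{\Sigma_T}$ on $\Sigma_T$, $\bar p(\cdot,T)=\bar y(\cdot,T)-y_d$ in the sense of transposition, that is $$\int_{\Omega_T}\bar p f\,dx\,dt+\int_{\Sigma_T}\bar p\,h\,dS\,dt=\int z\,d\mu_{\Omega_T}+\int z\,d\mu_{\Sigma_T}+\int_\Omega(\bar y(\cdot,T)-y_d)\,z(\cdot,T)\,dx$$ for all $f\in L^r(\Omega_T)$, $h\in L^s(\Sigma_T)$ and weak solutions $z\in W(0,T)\cap C(\overline\Omega_T)$ of $z_t+Az=f$, $\partial_{\nu_A}z=h$, $z(\cdot,0)=0$. Suppose that $$\int_0^T(\bar p+\alpha\bar u,u-\bar u)_{L^2(\Omega)}dt\ge0\ \ \forall u\in U_{ad},\qquad \int_0^T(\bar p+\beta\bar v,v-\bar v)_{L^2(\Gamma)}dt\ge0\ \ \forall v\in V_{ad},\qquad \langle\bar\mu,\bar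 y-\psi\rangle=0 ,$$ where $(\cdot,\cdot)$ denotes the corresponding integrals. System of the $k$-th augmented Lagrange subproblem. Let $\rho_k>0$ and $\mu_k\in L^2(\Omega_T)$ with $\mu_k\ge0$. Let $\bar u_k\in U_{ad}$, $\bar v_k\in V_{ad}$; let $\bar y_k\in W(0,T)\cap C(\overline\Omega_T)$ be the weak solution of $(\bar y_k)_t+A\bar y_k=\bar u_k$, $\partial_{\nu_A}\bar y_k=\bar v_k$, $\bar y_k(\cdot,0)=y_0$; let $\bar\mu_k=(\rho_k(\bar y_k-\psi)+\mu_k)_+$; let $\bar p_k\in W(0,T)$ be the weak solution of $-(\bar p_k)_t+A\bar p_k=\bar\mu_k$ in $\Omega_T$, $\partial_{\nu_A}\bar p_k=0$ on $\Sigma_T$, $\bar p_k(\cdot,T)=\bar y_k(\cdot,T)-y_d$; and suppose that $$\int_0^T(\bar p_k+\alpha\bar u_k,u-\bar u_k)_{L^2(\Omega)}dt\ge0\ \ \forall u\in U_{ad},\qquad \int_0^T(\bar p_k+\beta\bar v_k,v-\bar v_k)_{L^2(\Gamma)}dt\ge0\ \ \forall v\in V_{ad}.$$ Claim. Then $$\alpha\|\bar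 u-\bar u_k\|^2_{L^2(\Omega_T)}+\beta\|\bar v-\bar v_k\|^2_{L^2(\Sigma_T)}\le\int_0^T(\bar\mu_k,\psi-\bar y_k)_{L^2(\Omega)}\,dt+\langle\bar\mu,\bar y_k-\psi\rangle .$$ -/

import Mathlib

open MeasureTheory Filter Topology Set
open scoped ENNReal

namespace ParabolicControl

/-- Space `ℝᴺ` with its Euclidean norm; space-time points are pairs `(x, t) : E N × ℝ`. -/
abbrev E (N : ℕ) := EuclideanSpace ℝ (Fin N)

variable {N : ℕ}

/-- The boundary of `Ω` is of class `C^{1,1}`: near each boundary point, `Ω` is the strict subgraph,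
in some unit direction `n`, of a `C¹` function with Lipschitz derivative on the hyperplane
orthogonal to `n`. -/
def HasC11Boundary (Ω : Set (E N)) : Prop :=
  ∀ x₀ ∈ frontier Ω, ∃ (n : E N) (g : E N → ℝ) (K : NNReal) (U : Set (E N)),
    ‖n‖ = 1 ∧ ContDiff ℝ 1 g ∧ LipschitzWith K (fderiv ℝ g) ∧ IsOpen U ∧ x₀ ∈ U ∧
      ∀ x ∈ U, (x ∈ Ω ↔ inner ℝ n x < g (x - inner ℝ n x • n))

/-- Lebesgue measure on `Ω`. -/
noncomputable def space (Ω : Set (E N)) : Measure (E N) := volume.restrict Ω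

/-- Surface measure on the boundary of `Ω` (the `(N-1)`-dimensional Hausdorff measure, normalized
so that it is the Lebesgue measure on hyperplanes). -/
noncomputable def surface (Ω : Set (E N)) : Measure (E N) :=
  (Measure.euclideanHausdorffMeasure (N - 1)).restrict (frontier Ω)

/-- Lebesgue measure on `(0,T)`. -/
noncomputable def time (T : ℝ) : Measure ℝ := volume.restrict (Ioo 0 T)

/-- Lebesgue measure on `Ω_T = Ω × (0,T)`. -/
noncomputable def cyl (Ω : Set (E N)) (T : ℝ) : Measure (E N × ℝ) := (space Ω).prod (time T)

/-- The measure `dS dt` on `Σ_T = Γ × (0,T)`, where `Γ` is the boundary of `Ω`. -/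
noncomputable def lat (Ω : Set (E N)) (T : ℝ) : Measure (E N × ℝ) := (surface Ω).prod (time T)

/-- `F` is the weak gradient of `f` in `Ω`. -/
def HasWeakGrad (Ω : Set (E N)) (f : E N → ℝ) (F : E N → E N) : Prop :=
  ∀ φ : E N → ℝ, ContDiff ℝ (⊤ : ℕ∞) φ → HasCompactSupport φ → tsupport φ ⊆ Ω → ∀ i : Fin N,
    ∫ x, f x * fderiv ℝ φ x (EuclideanSpace.single i 1) ∂(space Ω) = - ∫ x, F x i * φ x ∂(space Ω)

/-- `h ∈ H¹(Ω)` with weak gradient `H`. -/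
def IsH1 (Ω : Set (E N)) (h : E N → ℝ) (H : E N → E N) : Prop :=
  MemLp h 2 (space Ω) ∧ MemLp H 2 (space Ω) ∧ HasWeakGrad Ω h H

/-- `w ∈ L²(0,T;H¹(Ω))` with weak spatial gradient `W`. -/
def IsL2H1 (Ω : Set (E N)) (T : ℝ) (w : E N × ℝ → ℝ) (W : E N × ℝ → E N) : Prop :=
  MemLp w 2 (cyl Ω T) ∧ MemLp W 2 (cyl Ω T) ∧
    ∀ᵐ t ∂(time T), HasWeakGrad Ω (fun x => w (x, t)) (fun x => W (x, t))

/-- `p ∈ L¹(0,T;W^{1,q}(Ω))` with weak spatial gradient `G`. -/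
def IsL1W1 (Ω : Set (E N)) (T : ℝ) (q : ℝ≥0∞) (p : E N × ℝ → ℝ) (G : E N × ℝ → E N) : Prop :=
  AEStronglyMeasurable p (cyl Ω T) ∧ AEStronglyMeasurable G (cyl Ω T) ∧
    (∀ᵐ t ∂(time T), HasWeakGrad Ω (fun x => p (x, t)) (fun x => G (x, t))) ∧
    ∫⁻ t, (eLpNorm (fun x => p (x, t)) q (space Ω) + eLpNorm (fun x => G (x, t)) q (space Ω))
      ∂(time T) < ∞

/-- `f ∈ W^{1,q}(Ω)` has boundary trace `g`: some sequence of smooth functions on `ℝᴺ` converges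
to `f` in `W^{1,q}(Ω)` while its boundary values converge to `g` in `L^q(Γ)`. -/
def IsTrace (Ω : Set (E N)) (q : ℝ≥0∞) (f g : E N → ℝ) : Prop :=
  ∃ F : E N → E N, MemLp f q (space Ω) ∧ MemLp F q (space Ω) ∧ MemLp g q (surface Ω) ∧
    ∃ φ : ℕ → E N → ℝ, (∀ n, ContDiff ℝ (⊤ : ℕ∞) (φ n)) ∧
      Tendsto (fun n => eLpNorm (φ n - f) q (space Ω)) atTop (𝓝 0) ∧
      Tendsto (fun n => eLpNorm (gradient (φ n) - F) q (space Ω)) atTop (𝓝 0) ∧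
      Tendsto (fun n => eLpNorm (φ n - g) q (surface Ω)) atTop (𝓝 0)

/-- `b` is the trace on `Σ_T` of `w`, taken at almost every time. -/
def IsLatTrace (Ω : Set (E N)) (T : ℝ) (q : ℝ≥0∞) (w b : E N × ℝ → ℝ) : Prop :=
  AEStronglyMeasurable b (lat Ω T) ∧
    ∀ᵐ t ∂(time T), IsTrace Ω q (fun x => w (x, t)) (fun x => b (x, t))

/-- The pair `(f, F)` represents the weak time derivative `y_t ∈ L²(0,T;H¹(Ω)*)` of `y`.
Every element of `L²(0,T;H¹(Ω)*)` has the form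
`⟨ℓ, w⟩ = ∫∫ (f w + F · ∇w) dx dt` with `f` and `F` square integrable on `Ω_T`
(Riesz representation), and `y_t = ℓ` means that `-∫∫ y φ' h = ∫∫ (f h + F · ∇h) φ`
for all smooth `φ` with compact support in `(0,T)` and all `h ∈ H¹(Ω)`. -/
def HasTimeDeriv (Ω : Set (E N)) (T : ℝ) (y f : E N × ℝ → ℝ) (F : E N × ℝ → E N) : Prop :=
  MemLp f 2 (cyl Ω T) ∧ MemLp F 2 (cyl Ω T) ∧
    ∀ φ : ℝ → ℝ, ContDiff ℝ (⊤ : ℕ∞) φ → HasCompactSupport φ → tsupport φ ⊆ Ioo 0 T →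
      ∀ (h : E N → ℝ) (H : E N → E N), IsH1 Ω h H →
        - ∫ z, y z * deriv φ z.2 * h z.1 ∂(cyl Ω T)
          = ∫ z, (f z * h z.1 + inner ℝ (F z) (H z.1)) * φ z.2 ∂(cyl Ω T)

/-- The `L²(Ω)`-continuous representative of `p` takes the value `g` at time `T`. -/
def HasTerminalValue (Ω : Set (E N)) (T : ℝ) (p : E N × ℝ → ℝ) (g : E N → ℝ) : Prop :=
  Tendsto (fun t => eLpNorm (fun x => p (x, t) - g x) 2 (space Ω))
    (𝓝[<] T ⊓ ae (volume : Measure ℝ)) (𝓝 0)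

/-- The data of the control problem with the standing assumptions on them. -/
structure Problem (N : ℕ) where
  Ω : Set (E N)
  T : ℝ
  r : ℝ≥0∞
  s : ℝ≥0∞
  α : ℝ
  β : ℝ
  /-- coefficients of `A y = -∑ ∂_{x_j} (a_{ij} ∂_{x_i} y)` -/
  a : Fin N → Fin N → E N → ℝ
  /-- initial state -/
  y0 : E N → ℝ
  /-- desired terminal state -/
  yd : E N → ℝ
  /-- upper bound for the state -/
  ψ : E N × ℝ → ℝ
  ua : E N × ℝ → ℝ
  ub : E N × ℝ → ℝ
  va : E N × ℝ → ℝ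
  vb : E N × ℝ → ℝ
  dim : N = 2 ∨ N = 3
  isOpen : IsOpen Ω
  isBounded : Bornology.IsBounded Ω
  boundary : HasC11Boundary Ω
  T_pos : 0 < T
  r_gt : (N : ℝ≥0∞) / 2 + 1 < r
  s_gt : (N : ℝ≥0∞) + 1 < s
  α_pos : 0 < α
  β_pos : 0 < β
  a_mem : ∀ i j, MemLp (a i j) ∞ (space Ω)
  a_symm : ∀ i j, ∀ᵐ x ∂(space Ω), a i j x = a j i x
  a_elliptic : ∃ θ : ℝ, 0 < θ ∧
    ∀ᵐ x ∂(space Ω), ∀ ξ : E N, θ * ‖ξ‖ ^ 2 ≤ ∑ i, ∑ j, a i j x * ξ i * ξ j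
  y0_cont : ContinuousOn y0 (closure Ω)
  yd_mem : MemLp yd 2 (space Ω)
  ψ_cont : ContinuousOn ψ (closure Ω ×ˢ Icc 0 T)
  ua_mem : MemLp ua r (cyl Ω T)
  ub_mem : MemLp ub r (cyl Ω T)
  u_lt : ∀ᵐ z ∂(cyl Ω T), ua z < ub z
  va_mem : MemLp va s (lat Ω T)
  vb_mem : MemLp vb s (lat Ω T)
  v_lt : ∀ᵐ z ∂(lat Ω T), va z < vb z

namespace Problem

/-- Distributed control space `L^r(Ω_T)`, admissible set. -/
def Uad (D : Problem N) : Set (E N × ℝ → ℝ) :=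
  {u | MemLp u D.r (cyl D.Ω D.T) ∧ ∀ᵐ z ∂(cyl D.Ω D.T), D.ua z ≤ u z ∧ u z ≤ D.ub z}

/-- Boundary control space `L^s(Σ_T)`, admissible set. -/
def Vad (D : Problem N) : Set (E N × ℝ → ℝ) :=
  {v | MemLp v D.s (lat D.Ω D.T) ∧ ∀ᵐ z ∂(lat D.Ω D.T), D.va z ≤ v z ∧ v z ≤ D.vb z}

/-- `y ∈ W(0,T) ∩ C(closure of Ω_T)` is the weak solution of `y_t + A y = f` in `Ω_T`,
`∂_{ν_A} y = g` on `Σ_T`, `y(·,0) = η`. -/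
def IsState (D : Problem N) (y f g : E N × ℝ → ℝ) (η : E N → ℝ) : Prop :=
  ContinuousOn y (closure D.Ω ×ˢ Icc 0 D.T) ∧ (∀ x ∈ closure D.Ω, y (x, 0) = η x) ∧
  ∃ (G : E N × ℝ → E N) (d : E N × ℝ → ℝ) (F : E N × ℝ → E N),
    IsL2H1 D.Ω D.T y G ∧ HasTimeDeriv D.Ω D.T y d F ∧
    ∀ (w : E N × ℝ → ℝ) (W : E N × ℝ → E N) (b : E N × ℝ → ℝ),
      IsL2H1 D.Ω D.T w W → IsLatTrace D.Ω D.T 2 w b → MemLp b 2 (lat D.Ω D.T) →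
        ∫ z, (d z * w z + inner ℝ (F z) (W z)) ∂(cyl D.Ω D.T)
          - ∫ z, g z * b z ∂(lat D.Ω D.T)
          + ∫ z, ∑ i, ∑ j, D.a i j z.1 * G z i * W z j ∂(cyl D.Ω D.T)
        = ∫ z, f z * w z ∂(cyl D.Ω D.T)

/-- `p ∈ W(0,T)` is the weak solution of `-p_t + A p = m` in `Ω_T`, `∂_{ν_A} p = 0` on `Σ_T`,
`p(·,T) = g`, for a square integrable right-hand side `m`. -/
def IsAdjoint (D : Problem N) (p m : E N × ℝ → ℝ) (g : E N → ℝ) : Prop :=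
  HasTerminalValue D.Ω D.T p g ∧
  ∃ (G : E N × ℝ → E N) (d : E N × ℝ → ℝ) (F : E N × ℝ → E N),
    IsL2H1 D.Ω D.T p G ∧ HasTimeDeriv D.Ω D.T p d F ∧
    ∀ (w : E N × ℝ → ℝ) (W : E N × ℝ → E N), IsL2H1 D.Ω D.T w W →
        - ∫ z, (d z * w z + inner ℝ (F z) (W z)) ∂(cyl D.Ω D.T)
          + ∫ z, ∑ i, ∑ j, D.a i j z.1 * G z i * W z j ∂(cyl D.Ω D.T)
        = ∫ z, m z * w z ∂(cyl D.Ω D.T)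

/-- `p ∈ L¹(0,T;W^{1,q}(Ω))`, `1 < q < N/(N-1)`, with trace `π` on `Σ_T`, is the solution of
`-p_t + A p = μΩ` in `Ω_T`, `∂_{ν_A} p = μS` on `Σ_T`, `p(·,T) = g`, for finite measures `μΩ`, `μS`.
The coefficients are merely bounded and the data are measures, so the solution is understood, as
usual, by transposition: the derivatives are put on test functions `z ∈ W(0,T) ∩ C(closure of Ω_T)`
with `z(·,0) = 0`, `z_t + A z = f ∈ L^r(Ω_T)` and `∂_{ν_A} z = h ∈ L^s(Σ_T)`. The pairings of
`p` with the control spaces are meaningful because `p` and its trace lie in the dual spaces. -/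
def IsMeasureAdjoint (D : Problem N) (p π : E N × ℝ → ℝ) (μΩ μS : Measure (E N × ℝ))
    (g : E N → ℝ) : Prop :=
  (∃ q : ℝ≥0∞, 1 < q ∧ q < (N : ℝ≥0∞) / ((N : ℝ≥0∞) - 1) ∧
    (∃ G : E N × ℝ → E N, IsL1W1 D.Ω D.T q p G) ∧ IsLatTrace D.Ω D.T q p π) ∧
  MemLp p (ENNReal.conjExponent D.r) (cyl D.Ω D.T) ∧
  MemLp π (ENNReal.conjExponent D.s) (lat D.Ω D.T) ∧
  ∀ z f h : E N × ℝ → ℝ, MemLp f D.r (cyl D.Ω D.T) → MemLp h D.s (lat D.Ω D.T) →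
    D.IsState z f h 0 →
      ∫ c, p c * f c ∂(cyl D.Ω D.T) + ∫ c, π c * h c ∂(lat D.Ω D.T)
        = ∫ c, z c ∂μΩ + ∫ c, z c ∂μS + ∫ x, g x * z (x, D.T) ∂(space D.Ω)

/-- The feasible triple `(y, u, v)`, the adjoint state `p` (with trace `π` on `Σ_T`) and the
nonnegative multiplier `μΩ + μS` satisfy the optimality system of the state-constrained problem. -/
structure OptimalitySystem (D : Problem N) (y u v p π : E N × ℝ → ℝ)
    (μΩ μS : Measure (E N × ℝ)) : Prop where
  u_adm : u ∈ D.Uad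
  v_adm : v ∈ D.Vad
  state : D.IsState y u v D.y0
  feasible : ∀ x ∈ D.Ω, ∀ t ∈ Ioo 0 D.T, y (x, t) ≤ D.ψ (x, t)
  finΩ : IsFiniteMeasure μΩ
  finS : IsFiniteMeasure μS
  concΩ : μΩ (D.Ω ×ˢ Ioo 0 D.T)ᶜ = 0
  concS : μS (frontier D.Ω ×ˢ Ioo 0 D.T)ᶜ = 0
  adjoint : D.IsMeasureAdjoint p π μΩ μS (fun x => y (x, D.T) - D.yd x)
  var_u : ∀ u' ∈ D.Uad, 0 ≤ ∫ z, (p z + D.α * u z) * (u' z - u z) ∂(cyl D.Ω D.T)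
  var_v : ∀ v' ∈ D.Vad, 0 ≤ ∫ z, (π z + D.β * v z) * (v' z - v z) ∂(lat D.Ω D.T)
  compl : ∫ z, (y z - D.ψ z) ∂(μΩ + μS) = 0

/-- The updated multiplier `(ρ (y - ψ) + μ)₊`. -/
noncomputable def multiplier (D : Problem N) (ρ : ℝ) (μ y : E N × ℝ → ℝ) : E N × ℝ → ℝ :=
  fun z => max (ρ * (y z - D.ψ z) + μ z) 0

/-- `(y, u, v)` and the adjoint state `p` (with trace `π` on `Σ_T`) satisfy the optimality system
of the augmented Lagrange subproblem with penalty parameter `ρ` and multiplier `μ`. -/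
structure AugmentedSystem (D : Problem N) (ρ : ℝ) (μ y u v p π : E N × ℝ → ℝ) : Prop where
  u_adm : u ∈ D.Uad
  v_adm : v ∈ D.Vad
  state : D.IsState y u v D.y0
  adjoint : D.IsAdjoint p (D.multiplier ρ μ y) (fun x => y (x, D.T) - D.yd x)
  trace : IsLatTrace D.Ω D.T 2 p π ∧ MemLp π 2 (lat D.Ω D.T)
  var_u : ∀ u' ∈ D.Uad, 0 ≤ ∫ z, (p z + D.α * u z) * (u' z - u z) ∂(cyl D.Ω D.T)
  var_v : ∀ v' ∈ D.Vad, 0 ≤ ∫ z, (π z + D.β * v z) * (v' z - v z) ∂(lat D.Ω D.T)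

end Problem

end ParabolicControl

/-! Test each pair of variational inequalities with the other control and add. With z = yk - y, the
left side of the claim is at most [∫ p (uk - u) + ∫ π (vk - v)] - [∫ pk (uk - u) + ∫ πk (vk - v)].
Since z is a state with zero initial value, driven by uk - u and vk - v, transposition turns the
first bracket into ∫ z d(μΩ + μS) + ∫ (y(T) - yd) z(T). Duality with the regular adjoint turns the
second into ∫ m z + ∫ (yk(T) - yd) z(T), where m is the updated multiplier. The terminal terms
differ by -‖z(T)‖² ≤ 0. Complementarity replaces y by ψ in the measure integral, and m ≥ 0 with y ≤
ψ gives -m z = m (y - yk) ≤ m (ψ - yk).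

Transposition is part of the definition of p, but the duality for pk must be proved
(`IsState.integral_adjoint`). It rests on integration by parts in time,
`integral_timeDeriv_add_integral_timeDeriv`, obtained by time shifts. Extend everything by zero in
time and correlate y_t with p shifted one way, and p_t with y shifted the other way. The
correlations are continuous in the shift, because translation is continuous in L². Averaged over
shifts in (0,ε), they are differences of L²(Ω) pairings; these telescope by translation invariance
and leave only the average of ∫ g y(t) over (T - ε, T). Hence the identity holds at shift zero.

The differences come from the integrated form of the weak time derivative, a du Bois-Reymond
argument for each fixed test function in H¹(Ω). Here the test function is itself a time slice, so an
exceptional null set of times depending on it is not allowed. Continuity of y removes it on one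
side, separability of H¹(Ω) on the other. -/

namespace ParabolicControl

/-! ### Finiteness of the surface measure and of the space-time measures -/

/-- On a `C^{1,1}` boundary the surface measure is locally finite. -/
theorem HasC11Boundary.exists_nhdsWithin_lt_top {N : ℕ} {Ω : Set (E N)} (hΩ : IsOpen Ω)
    (hb : HasC11Boundary Ω) {x₀ : E N} (hx₀ : x₀ ∈ frontier Ω) :
    ∃ V ∈ 𝓝[frontier Ω] x₀,
      (Measure.euclideanHausdorffMeasure (N - 1) : Measure (E N)) V < ∞ := by
  obtain ⟨n, g, K, U, hn, hg, -, hU, hxU, hsub⟩ := hb x₀ hx₀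
  have hn0 : n ≠ 0 := by rintro rfl; simp at hn
  set P : E N → E N := fun x => x - inner ℝ n x • n with hP
  have hPc : Continuous P := by fun_prop
  -- Being `C¹`, `g` is already Lipschitz near `P x₀`; intersecting with a ball makes the parameter
  -- set bounded as well.
  obtain ⟨L, t, ht, hL⟩ := hg.contDiffAt (x := P x₀) |>.exists_lipschitzOnWith
  set S : Set (E N) := t ∩ Metric.ball (P x₀) 1
  have hS : S ∈ 𝓝 (P x₀) := inter_mem ht (Metric.ball_mem_nhds _ one_pos)
  refine ⟨frontier Ω ∩ (U ∩ P ⁻¹' S), ?_, ?_⟩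
  · exact inter_mem self_mem_nhdsWithin (mem_nhdsWithin_of_mem_nhds
      (inter_mem (hU.mem_nhds hxU) (hPc.continuousAt.preimage_mem_nhds hS)))
  let M := (ℝ ∙ n)ᗮ
  have hfr : Module.finrank ℝ M = N - 1 := by
    have h1 := Submodule.finrank_add_finrank_orthogonal (ℝ ∙ n)
    rw [finrank_span_singleton hn0, finrank_euclideanSpace_fin] at h1
    change Module.finrank ℝ (ℝ ∙ n)ᗮ = N - 1
    omega
  let Ψ : M → E N := fun ξ => (ξ : E N) + g ξ • n
  let A : Set M := (fun ξ : M => (ξ : E N)) ⁻¹' S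
  have hΨ : LipschitzOnWith (1 + L) Ψ A := by
    apply LipschitzOnWith.of_dist_le_mul
    intro a ha b hb
    have h1 : dist (g a) (g b) ≤ L * dist a b := hL.dist_le_mul _ ha.1 _ hb.1
    have h2 : Ψ a - Ψ b = ((a : E N) - b) + (g a - g b) • n := by
      simp only [Ψ, sub_smul]; abel
    rw [dist_eq_norm, h2]
    refine (norm_add_le _ _).trans ?_
    rw [norm_smul, hn, mul_one, ← dist_eq_norm, ← dist_eq_norm]
    change dist a b + dist (g a) (g b) ≤ ((1 + L : NNReal) : ℝ) * dist a b
    push_cast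
    linarith
  have hsubset : frontier Ω ∩ (U ∩ P ⁻¹' S) ⊆ Ψ '' A := by
    rintro x ⟨hxf, hxU, hxS⟩
    -- A boundary point lies on the graph: it is not in the open set Ω, which gives one inequality,
    -- and it is a limit of points of Ω ∩ U, which gives the other.
    have hnot : x ∉ Ω := by
      rw [hΩ.frontier_eq] at hxf; exact hxf.2
    have hle : g (P x) ≤ inner ℝ n x := by
      rw [hsub x hxU] at hnot; exact not_lt.mp hnot
    have hge : inner ℝ n x ≤ g (P x) := by
      have hcl : x ∈ closure (Ω ∩ U) := by
        have := hU.inter_closure (s := U) (t := Ω) ⟨hxU, frontier_subset_closure hxf⟩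
        rwa [inter_comm]
      have hclosed : IsClosed {x : E N | inner ℝ n x ≤ g (P x)} :=
        isClosed_le (by fun_prop) (hg.continuous.comp hPc)
      refine closure_minimal ?_ hclosed hcl
      rintro z ⟨hz, hzU⟩
      exact ((hsub z hzU).1 hz).le
    have hPM : P x ∈ M := by
      rw [Submodule.mem_orthogonal_singleton_iff_inner_right]
      simp [hP, inner_sub_right, inner_smul_right, hn]
    refine ⟨⟨P x, hPM⟩, hxS, ?_⟩
    simp only [Ψ, hP]
    rw [show g (x - inner ℝ n x • n) = inner ℝ n x from le_antisymm hle hge]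
    simp
  have hA : (Measure.hausdorffMeasure ((N - 1 : ℕ) : ℝ) : Measure M) A < ∞ := by
    -- On the hyperplane M, of dimension N - 1, this Hausdorff measure is a Haar measure, hence
    -- finite on bounded sets; the Lipschitz graph map carries the bound to the boundary.
    have hH : (Measure.hausdorffMeasure ((N - 1 : ℕ) : ℝ) : Measure M).IsAddHaarMeasure := by
      rw [← hfr]; exact isAddHaarMeasure_hausdorffMeasure
    refine Bornology.IsBounded.measure_lt_top ?_
    refine (Metric.isBounded_iff_subset_ball (⟨0, M.zero_mem⟩ : M)).2 ⟨1 + ‖P x₀‖, ?_⟩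
    rintro ξ ⟨-, hξ⟩
    rw [Metric.mem_ball, dist_eq_norm] at hξ ⊢
    have : ‖(ξ : E N)‖ < 1 + ‖P x₀‖ := by
      have := norm_sub_norm_le (ξ : E N) (P x₀); linarith
    simpa using this
  rw [Measure.euclideanHausdorffMeasure_def, Measure.smul_apply, ENNReal.smul_def, smul_eq_mul]
  refine ENNReal.mul_lt_top ENNReal.coe_lt_top ?_
  refine (measure_mono hsubset).trans_lt ?_
  refine (hΨ.hausdorffMeasure_image_le (by positivity)).trans_lt ?_
  refine ENNReal.mul_lt_top ?_ hA
  exact ENNReal.rpow_lt_top_of_nonneg (by positivity) ENNReal.coe_ne_top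

theorem surface_univ_lt_top {N : ℕ} {Ω : Set (E N)} (hΩ : IsOpen Ω)
    (hbd : Bornology.IsBounded Ω) (hb : HasC11Boundary Ω) : surface Ω univ < ∞ := by
  have hK : IsCompact (frontier Ω) :=
    Metric.isCompact_of_isClosed_isBounded isClosed_frontier
      (hbd.closure.subset frontier_subset_closure)
  rw [surface, Measure.restrict_apply_univ]
  exact hK.measure_lt_top_of_nhdsWithin fun x hx => hb.exists_nhdsWithin_lt_top hΩ hx

namespace Problem

variable {N : ℕ}

instance isFiniteMeasure_space (D : Problem N) : IsFiniteMeasure (space D.Ω) :=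
  ⟨by rw [space, Measure.restrict_apply_univ]; exact D.isBounded.measure_lt_top⟩

instance isFiniteMeasure_surface (D : Problem N) : IsFiniteMeasure (surface D.Ω) :=
  ⟨surface_univ_lt_top D.isOpen D.isBounded D.boundary⟩

end Problem

instance isFiniteMeasure_time (T : ℝ) : IsFiniteMeasure (time T) := by
  unfold time; infer_instance

namespace Problem

variable {N : ℕ}

instance isFiniteMeasure_cyl (D : Problem N) : IsFiniteMeasure (cyl D.Ω D.T) := by
  unfold cyl; infer_instance

instance isFiniteMeasure_lat (D : Problem N) : IsFiniteMeasure (lat D.Ω D.T) := by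
  unfold lat; infer_instance

end Problem
end ParabolicControl

/-! ### The du Bois-Reymond lemma on (0,T) -/

namespace ParabolicControl

/-- A smooth function of zero mean with compact support in `(0,T)` is the derivative of a smooth
function with compact support in `(0,T)`. -/
theorem exists_contDiff_primitive {T : ℝ} {θ : ℝ → ℝ} (hθ : ContDiff ℝ (⊤ : ℕ∞) θ)
    (hc : HasCompactSupport θ) (hs : tsupport θ ⊆ Ioo 0 T) (h0 : ∫ t, θ t = 0) :
    ∃ Θ : ℝ → ℝ, ContDiff ℝ (⊤ : ℕ∞) Θ ∧ HasCompactSupport Θ ∧ tsupport Θ ⊆ Ioo 0 T ∧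
      deriv Θ = θ := by
  rcases (tsupport θ).eq_empty_or_nonempty with he | hne
  · refine ⟨0, contDiff_const, HasCompactSupport.zero, by simp, ?_⟩
    rw [tsupport_eq_empty_iff] at he
    ext t; simp [he]
  -- The extreme points of the support lie in it, hence in (0,T), so [a,b] is a compact subset of
  -- (0,T) that can carry the primitive.
  obtain ⟨a, haC, ha⟩ := hc.exists_isLeast hne
  obtain ⟨b, hbC, hb⟩ := hc.exists_isGreatest hne
  have hzero : ∀ t, t ∉ Icc a b → θ t = 0 := fun t ht => by
    by_contra h
    have := subset_tsupport θ (Function.mem_support.2 h)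
    exact ht ⟨ha this, hb this⟩
  let Θ : ℝ → ℝ := fun t => ∫ s in (0 : ℝ)..t, θ s
  have hderiv : ∀ t, HasDerivAt Θ (θ t) t := fun t =>
    intervalIntegral.integral_hasDerivAt_right (hθ.continuous.intervalIntegrable _ _)
      (hθ.continuous.stronglyMeasurableAtFilter _ _) hθ.continuous.continuousAt
  have hd : deriv Θ = θ := funext fun t => (hderiv t).deriv
  have hsub : tsupport Θ ⊆ Icc a b := by
    refine closure_minimal (fun t ht => ?_) isClosed_Icc
    by_contra hnot
    refine ht ?_
    change ∫ s in (0 : ℝ)..t, θ s = 0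
    by_cases hta : t < a
    · rw [intervalIntegral.integral_congr (g := fun _ => 0) (fun s hs' => ?_)]
      · simp
      · refine hzero s fun h => ?_
        have := hs'.2
        have h2 := (hs haC).1
        have h1 : s ≤ max 0 t := this
        rcases le_max_iff.1 h1 with h3 | h3 <;> linarith [h.1]
    -- Beyond the support the primitive equals the full integral; this is where zero mean enters.
    · have hbt : b < t := by
        by_contra h; exact hnot ⟨not_lt.1 hta, not_lt.1 h⟩
      rw [intervalIntegral.integral_eq_integral_of_support_subset, h0]
      intro s hs'
      have h1 := subset_tsupport θ hs'
      exact ⟨(hs h1).1, (hb h1).trans hbt.le⟩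
  refine ⟨Θ, ?_, ?_, ?_, hd⟩
  · rw [contDiff_infty_iff_deriv]
    exact ⟨fun t => (hderiv t).differentiableAt, hd ▸ hθ⟩
  · exact isCompact_Icc.of_isClosed_subset (isClosed_tsupport _) hsub
  · exact hsub.trans fun t ht => ⟨(hs haC).1.trans_le ht.1, ht.2.trans_lt (hs hbC).2⟩

/-- An integrable function on `(0,T)` with integrable weak derivative `k` agrees almost everywhere
with a primitive of `k`. -/
theorem ae_eq_const_add_integral {T : ℝ} (hT : 0 < T) {m k : ℝ → ℝ}
    (hm : Integrable m (time T)) (hk : Integrable k (time T))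
    (h : ∀ φ : ℝ → ℝ, ContDiff ℝ (⊤ : ℕ∞) φ → HasCompactSupport φ → tsupport φ ⊆ Ioo 0 T →
      - ∫ t, m t * deriv φ t ∂(time T) = ∫ t, k t * φ t ∂(time T)) :
    ∃ c, ∀ᵐ t ∂(time T), m t = c + ∫ s in (0 : ℝ)..t, k s := by
  have hki : IntervalIntegrable k volume 0 T := by
    rw [intervalIntegrable_iff_integrableOn_Ioo_of_le hT.le]; exact hk
  let K : ℝ → ℝ := fun t => ∫ s in (0 : ℝ)..t, k s
  have hKac : AbsolutelyContinuousOnInterval K 0 T :=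
    hki.absolutelyContinuousOnInterval_intervalIntegral left_mem_uIcc
  have hKi : Integrable K (time T) := by
    have := hKac.continuousOn.integrableOn_compact (μ := volume) isCompact_uIcc
    rw [uIcc_of_le hT.le] at this
    exact this.mono_set Ioo_subset_Icc_self
  have htime : ∀ f : ℝ → ℝ, ∫ t, f t ∂(time T) = ∫ t in (0 : ℝ)..T, f t := fun f => by
    rw [intervalIntegral.integral_of_le hT.le, integral_Ioc_eq_integral_Ioo]; rfl
  have hKparts : ∀ φ : ℝ → ℝ, ContDiff ℝ (⊤ : ℕ∞) φ → HasCompactSupport φ →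
      tsupport φ ⊆ Ioo 0 T → - ∫ t, K t * deriv φ t ∂(time T) = ∫ t, k t * φ t ∂(time T) := by
    intro φ hφ _ hs
    have hφac : AbsolutelyContinuousOnInterval φ 0 T :=
      (hφ.contDiffOn.of_le (by exact_mod_cast le_top)).absolutelyContinuousOnInterval
    have hb : ∀ t, t ∉ Ioo 0 T → φ t = 0 := fun t ht =>
      image_eq_zero_of_notMem_tsupport fun h => ht (hs h)
    rw [htime, htime, hKac.integral_mul_deriv_eq_deriv_mul hφac, hb T (by simp), hb 0 (by simp)]
    simp only [mul_zero, sub_self, zero_sub, neg_neg]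
    refine intervalIntegral.integral_congr_ae ?_
    filter_upwards [hki.ae_hasDerivAt_integral] with t ht ht'
    rw [(ht (uIoc_subset_uIcc ht') 0 left_mem_uIcc).deriv]
  have hbd : ∀ φ : ℝ → ℝ, Continuous φ → HasCompactSupport φ → ∀ f : ℝ → ℝ,
      Integrable f (time T) → Integrable (fun t => f t * φ t) (time T) := by
    intro φ hφ hc f hf
    obtain ⟨C, hC⟩ := hφ.bounded_above_of_compact_support hc
    exact hf.mul_bdd hφ.aestronglyMeasurable (ae_of_all _ hC)
  -- A bump η of unit mass inside (0,T). Subtracting (∫ φ) η from a test function φ leaves zero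
  -- mean, hence a derivative Θ', and `m - K` annihilates Θ'. The constant is therefore the value of
  -- `m - K` against η.
  let φ₀ : ContDiffBump (T / 2) := ⟨T / 8, T / 4, by positivity, by linarith⟩
  let η : ℝ → ℝ := φ₀.normed volume
  have hη : ContDiff ℝ (⊤ : ℕ∞) η := φ₀.contDiff_normed
  have hηc : HasCompactSupport η := φ₀.hasCompactSupport_normed
  have hηs : tsupport η ⊆ Ioo 0 T := by
    rw [show tsupport η = _ from φ₀.tsupport_normed_eq, Real.closedBall_eq_Icc]
    intro t ht
    have h1 : T / 2 - T / 4 ≤ t := ht.1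
    have h2 : t ≤ T / 2 + T / 4 := ht.2
    constructor <;> linarith
  have hη1 : ∫ t, η t = 1 := φ₀.integral_normed
  have hf : Integrable (fun t => m t - K t) (time T) := hm.sub hKi
  let c := ∫ t, (m t - K t) * η t ∂(time T)
  refine ⟨c, ?_⟩
  have hres : ∀ᵐ t, t ∈ Ioo 0 T → m t - K t - c = 0 := by
    refine isOpen_Ioo.ae_eq_zero_of_integral_contDiff_smul_eq_zero (μ := volume) ?_ ?_
    · exact (show IntegrableOn _ _ _ from hf.sub (integrable_const c)).locallyIntegrableOn
    intro φ hφ hφc hφs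
    let I := ∫ t, φ t
    have hφi : Integrable φ := hφ.continuous.integrable_of_hasCompactSupport hφc
    have hηi : Integrable η := hη.continuous.integrable_of_hasCompactSupport hηc
    have hθs : tsupport (fun t => φ t - I * η t) ⊆ tsupport φ ∪ tsupport η := by
      refine closure_minimal (fun t ht => ?_)
        ((isClosed_tsupport _).union (isClosed_tsupport _))
      by_contra hnot
      simp only [mem_union, not_or] at hnot
      exact ht (by simp [image_eq_zero_of_notMem_tsupport hnot.1,
        image_eq_zero_of_notMem_tsupport hnot.2])
    obtain ⟨Θ, h1, h2, h3, h4⟩ := exists_contDiff_primitive (T := T)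
      (θ := fun t => φ t - I * η t) (hφ.sub (contDiff_const.mul hη))
      ((hφc.isCompact.union hηc.isCompact).of_isClosed_subset (isClosed_tsupport _) hθs)
      (hθs.trans (union_subset hφs hηs))
      (by rw [integral_sub hφi (hηi.const_mul _), integral_const_mul, hη1]; simp [I])
    have e1 := h Θ h1 h2 h3
    have e2 := hKparts Θ h1 h2 h3
    have e3 : ∫ t, (m t - K t) * deriv Θ t ∂(time T) = 0 := by
      have hdc : Continuous (deriv Θ) := h1.continuous_deriv (by simp)
      simp only [sub_mul]
      rw [integral_sub (hbd _ hdc h2.deriv _ hm) (hbd _ hdc h2.deriv _ hKi)]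
      linarith
    rw [h4] at e3
    have e4 : ∫ t, (m t - K t) * φ t ∂(time T) - I * c = 0 := by
      rw [← e3, ← integral_const_mul, ← integral_sub (hbd _ hφ.continuous hφc _ hf)
        ((hbd _ hη.continuous hηc _ hf).const_mul _)]
      refine integral_congr_ae (ae_of_all _ fun t => ?_)
      ring
    have hI : I = ∫ t, φ t ∂(time T) := by
      refine (setIntegral_eq_integral_of_forall_compl_eq_zero fun t ht => ?_).symm
      exact image_eq_zero_of_notMem_tsupport fun h => ht (hφs h)
    have e5 : ∫ t, φ t • (m t - K t - c) = ∫ t, φ t * (m t - K t - c) ∂(time T) := by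
      refine (setIntegral_eq_integral_of_forall_compl_eq_zero fun t ht => ?_).symm
      rw [image_eq_zero_of_notMem_tsupport fun h => ht (hφs h), zero_smul]
    rw [e5]
    rw [hI, mul_comm, ← integral_const_mul, ← integral_sub (hbd _ hφ.continuous hφc _ hf)
      (hφi.integrableOn.const_mul c)] at e4
    rw [← e4]
    refine integral_congr_ae (ae_of_all _ fun t => ?_)
    ring
  rw [time, ae_restrict_iff' measurableSet_Ioo]
  filter_upwards [hres] with t ht htm
  linarith [ht htm]

end ParabolicControl

/-! ### Time translations and correlations in L² -/

namespace ParabolicControl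

section Translation

variable {N : ℕ} {V : Type*} [NormedAddCommGroup V] [InnerProductSpace ℝ V]

theorem integrable_inner_of_memLp {X : Type*} [MeasurableSpace X] {μ : Measure X} {f g : X → V}
    (hf : MemLp f 2 μ) (hg : MemLp g 2 μ) : Integrable (fun x => inner ℝ (f x) (g x)) μ := by
  refine (L2.integrable_inner (𝕜 := ℝ) hf.toLp hg.toLp).congr ?_
  filter_upwards [hf.coeFn_toLp, hg.coeFn_toLp] with x hx hy
  rw [hx, hy]

/-- Almost every time slice of a square integrable function is square integrable. -/
theorem ae_memLp_two_slice {V X Y : Type*} [MeasurableSpace X] [MeasurableSpace Y] {μ : Measure X}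
    {ν : Measure Y} [SFinite μ] [SFinite ν] [NormedAddCommGroup V] {f : X × Y → V}
    (hf : MemLp f 2 (μ.prod ν)) :
    ∀ᵐ t ∂ν, MemLp (fun x => f (x, t)) 2 μ := by
  have h1 := (memLp_two_iff_integrable_sq_norm hf.1).1 hf
  filter_upwards [h1.prod_left_ae, hf.1.prodMk_right] with t h2 h3
  exact (memLp_two_iff_integrable_sq_norm h3).2 h2

theorem measurePreserving_translate (ν : Measure (E N)) [SFinite ν] (σ : ℝ) :
    MeasurePreserving (fun z : E N × ℝ => (z.1, z.2 + σ)) (ν.prod volume) (ν.prod volume) :=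
  (MeasurePreserving.id ν).prod (measurePreserving_add_right volume σ)

/-- The correlation of two square integrable functions is continuous in the time shift. -/
theorem continuous_integral_inner_translate {ν : Measure (E N)} [IsFiniteMeasure ν]
    {f g : E N × ℝ → V} (hf : MemLp f 2 (ν.prod volume)) (hg : MemLp g 2 (ν.prod volume)) :
    Continuous fun σ : ℝ => ∫ z, inner ℝ (f (z.1, z.2 + σ)) (g z) ∂(ν.prod volume) := by
  -- The shifts form a continuous family of measure-preserving maps, so composition with them is
  -- continuous into L².
  let G : ℝ → C(E N × ℝ, E N × ℝ) := fun σ => ⟨fun z => (z.1, z.2 + σ), by fun_prop⟩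
  have hG : Continuous G := by
    refine ContinuousMap.continuous_of_continuous_uncurry _ ?_
    change Continuous fun p : ℝ × (E N × ℝ) => (p.2.1, p.2.2 + p.1)
    fun_prop
  have hmp : ∀ σ, MeasurePreserving (G σ) (ν.prod volume) (ν.prod volume) :=
    fun σ => measurePreserving_translate ν σ
  have hc := (continuous_const (y := hf.toLp)).compMeasurePreservingLp hG hmp (by simp)
  refine (hc.inner (𝕜 := ℝ) (continuous_const (y := hg.toLp))).congr fun σ => ?_
  rw [L2.inner_def]
  refine integral_congr_ae ?_
  filter_upwards [Lp.coeFn_compMeasurePreserving hf.toLp (hmp σ), hg.coeFn_toLp,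
    (hmp σ).quasiMeasurePreserving.ae_eq_comp hf.coeFn_toLp] with z h1 h2 h3
  rw [h1, h2, h3]
  rfl

/-- Every translate has the same L² norm and τ is finite. This joint square integrability in point
and shift justifies Fubini when correlations are averaged over shifts. -/
theorem memLp_translate {V : Type*} [NormedAddCommGroup V] {ν : Measure (E N)} [IsFiniteMeasure ν]
    {f : E N × ℝ → V} (hf : MemLp f 2 (ν.prod volume)) (τ : Measure ℝ) [IsFiniteMeasure τ] :
    MemLp (fun w : (E N × ℝ) × ℝ => f (w.1.1, w.1.2 + w.2)) 2 ((ν.prod volume).prod τ) := by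
  have hq : Measure.QuasiMeasurePreserving (fun w : (E N × ℝ) × ℝ => (w.1.1, w.1.2 + w.2))
      ((ν.prod volume).prod τ) (ν.prod volume) :=
    QuasiMeasurePreserving.prod_of_left (by fun_prop)
      (ae_of_all _ fun σ => (measurePreserving_translate ν σ).quasiMeasurePreserving)
  have hm := hf.1.comp_quasiMeasurePreserving hq
  refine (memLp_two_iff_integrable_sq_norm hm).2 ?_
  have hfi := (memLp_two_iff_integrable_sq_norm hf.1).1 hf
  refine (integrable_prod_iff' (hm.norm.pow 2)).2 ⟨ae_of_all _ fun σ => ?_, ?_⟩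
  · exact (measurePreserving_translate ν σ).integrable_comp_of_integrable hfi
  · refine (integrable_const (∫ z, ‖f z‖ ^ 2 ∂(ν.prod volume))).congr (ae_of_all _ fun σ => ?_)
    have h := integral_map (measurePreserving_translate ν σ).measurable.aemeasurable
      (f := fun z => ‖f z‖ ^ 2)
      (by rw [(measurePreserving_translate ν σ).map_eq]; exact hfi.1)
    rw [(measurePreserving_translate ν σ).map_eq] at h
    rw [h]
    refine integral_congr_ae (ae_of_all _ fun z => ?_)
    simp

/-- Integrating the correlation over a range of shifts. -/
theorem intervalIntegral_integral_inner_translate {ν : Measure (E N)} [IsFiniteMeasure ν]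
    {f g : E N × ℝ → V} (hf : MemLp f 2 (ν.prod volume)) (hg : MemLp g 2 (ν.prod volume))
    {a b : ℝ} (hab : a ≤ b) :
    ∫ σ in a..b, ∫ z, inner ℝ (f (z.1, z.2 + σ)) (g z) ∂(ν.prod volume)
      = ∫ t, ∫ s in (t + a)..(t + b), ∫ x, inner ℝ (f (x, s)) (g (x, t)) ∂ν := by
  let τ : Measure ℝ := volume.restrict (Ioc a b)
  have hF := memLp_translate hf τ
  have hG : MemLp (fun w : (E N × ℝ) × ℝ => g w.1) 2 ((ν.prod volume).prod τ) := hg.comp_fst τ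
  have hI := integrable_inner_of_memLp hF hG
  rw [intervalIntegral.integral_of_le hab]
  rw [integral_integral_swap (μ := τ) (ν := ν.prod volume)
    (f := fun σ z => inner ℝ (f (z.1, z.2 + σ)) (g z)) hI.swap]
  rw [integral_prod_symm _ hI.integral_prod_left]
  refine integral_congr_ae ?_
  -- Reorders (x, σ, t) to (x, t, σ), so that for almost every fixed t the integrals in x and σ can
  -- be swapped.
  have hmp : MeasurePreserving (fun w : (E N × ℝ) × ℝ => ((w.1.1, w.2), w.1.2))
      ((ν.prod τ).prod volume) ((ν.prod volume).prod τ) := by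
    have h1 := (measurePreserving_prodAssoc ν τ (volume : Measure ℝ))
    have h2 := (MeasurePreserving.id ν).prod
      (Measure.measurePreserving_swap (μ := τ) (ν := (volume : Measure ℝ)))
    have h3 := (measurePreserving_prodAssoc ν (volume : Measure ℝ) τ).symm
    exact h3.comp (h2.comp h1)
  have hI' := hmp.integrable_comp_of_integrable hI
  filter_upwards [hI'.prod_left_ae] with t ht
  rw [integral_integral_swap (μ := ν) (ν := τ)
    (f := fun x σ => inner ℝ (f (x, t + σ)) (g (x, t))) ht]
  rw [← intervalIntegral.integral_of_le hab]
  exact intervalIntegral.integral_comp_add_left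
    (fun s => ∫ x, inner ℝ (f (x, s)) (g (x, t)) ∂ν) t

end Translation

end ParabolicControl

/-! ### Pairings with H¹(Ω) and the integrated weak time derivative -/

namespace ParabolicControl

section InnerLp

variable {V X : Type*} [NormedAddCommGroup V] [InnerProductSpace ℝ V] [MeasurableSpace X]
  {μ : Measure X}

theorem abs_integral_inner_le {f g : X → V} (hf : MemLp f 2 μ) (hg : MemLp g 2 μ) :
    |∫ x, inner ℝ (f x) (g x) ∂μ| ≤ (eLpNorm f 2 μ).toReal * (eLpNorm g 2 μ).toReal := by
  have h := abs_real_inner_le_norm hf.toLp hg.toLp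
  rw [L2.inner_def, Lp.norm_toLp, Lp.norm_toLp] at h
  convert h using 2
  refine integral_congr_ae ?_
  filter_upwards [hf.coeFn_toLp, hg.coeFn_toLp] with x hx hy
  rw [hx, hy]

theorem tendsto_integral_inner {ι : Type*} {l : Filter ι} {f g : X → V} {G : ι → X → V}
    (hf : MemLp f 2 μ) (hg : MemLp g 2 μ) (hG : ∀ i, MemLp (G i) 2 μ)
    (h : Tendsto (fun i => eLpNorm (G i - g) 2 μ) l (𝓝 0)) :
    Tendsto (fun i => ∫ x, inner ℝ (f x) (G i x) ∂μ) l (𝓝 (∫ x, inner ℝ (f x) (g x) ∂μ)) := by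
  rw [tendsto_iff_dist_tendsto_zero]
  have h2 : Tendsto (fun i => (eLpNorm f 2 μ).toReal * (eLpNorm (G i - g) 2 μ).toReal) l (𝓝 0) := by
    have := ((ENNReal.tendsto_toReal ENNReal.zero_ne_top).comp h).const_mul (eLpNorm f 2 μ).toReal
    simpa using this
  refine squeeze_zero (fun _ => dist_nonneg) (fun i => ?_) h2
  rw [Real.dist_eq, ← integral_sub (integrable_inner_of_memLp hf (hG i))
    (integrable_inner_of_memLp hf hg)]
  simp only [← inner_sub_right]
  exact abs_integral_inner_le hf ((hG i).sub hg)

omit [InnerProductSpace ℝ V] in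
theorem tendsto_eLpNorm_comp_fst {ι Y : Type*} [MeasurableSpace Y] {l : Filter ι} {τ : Measure Y}
    [SFinite μ] [IsFiniteMeasure τ] {G : ι → X → V} (hG : ∀ i, AEStronglyMeasurable (G i) μ)
    (h : Tendsto (fun i => eLpNorm (G i) 2 μ) l (𝓝 0)) :
    Tendsto (fun i => eLpNorm (fun z : X × Y => G i z.1) 2 (μ.prod τ)) l (𝓝 0) := by
  have he : ∀ i, eLpNorm (fun z : X × Y => G i z.1) 2 (μ.prod τ)
      = (τ univ) ^ (1 / (2 : ℝ≥0∞)).toReal * eLpNorm (G i) 2 μ := fun i => by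
    have h1 : Measure.map Prod.fst (μ.prod τ) = τ univ • μ := by simp
    rw [← smul_eq_mul, ← eLpNorm_smul_measure_of_ne_top (by simp), ← h1,
      eLpNorm_map_measure (by rw [h1]; exact (hG i).smul_measure _) (by fun_prop)]
    rfl
  simp only [he]
  have hne : (τ univ) ^ (1 / (2 : ℝ≥0∞)).toReal ≠ ∞ :=
    ENNReal.rpow_ne_top_of_nonneg (by simp) (measure_ne_top _ _)
  simpa using ENNReal.Tendsto.const_mul h (Or.inr hne)

end InnerLp

variable {N : ℕ}

/-- A function and a vector field combined into one Hilbert space valued function. -/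
noncomputable def jet {X : Type*} (f : X → ℝ) (F : X → E N) : X → WithLp 2 (ℝ × E N) :=
  fun z => WithLp.toLp 2 (f z, F z)

theorem inner_jet {X Y : Type*} (f : X → ℝ) (F : X → E N) (h : Y → ℝ) (H : Y → E N)
    (x : X) (y : Y) :
    inner ℝ (jet f F x) (jet h H y) = f x * h y + inner ℝ (F x) (H y) := by
  simp [jet, mul_comm]

theorem memLp_jet {X : Type*} [MeasurableSpace X] {μ : Measure X} {f : X → ℝ} {F : X → E N}
    (hf : MemLp f 2 μ) (hF : MemLp F 2 μ) : MemLp (jet f F) 2 μ :=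
  MemLp.of_fst_of_snd_prodLp ⟨hf, hF⟩

theorem IsH1.memLp_jet {Ω : Set (E N)} {h : E N → ℝ} {H : E N → E N} (hh : IsH1 Ω h H) :
    MemLp (jet h H) 2 (space Ω) :=
  ParabolicControl.memLp_jet hh.1 hh.2.1

theorem isH1_zero (Ω : Set (E N)) : IsH1 Ω 0 0 :=
  ⟨MemLp.zero, MemLp.zero, fun φ _ _ _ i => by simp⟩

/-- `H¹(Ω)` is separable. -/
theorem exists_dense_seq_isH1 (Ω : Set (E N)) :
    ∃ s : ℕ → (E N → ℝ) × (E N → E N), (∀ n, IsH1 Ω (s n).1 (s n).2) ∧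
      ∀ h H, IsH1 Ω h H → ∃ k : ℕ → ℕ,
        Tendsto (fun n => eLpNorm (jet (s (k n)).1 (s (k n)).2 - jet h H) 2 (space Ω))
          atTop (𝓝 0) := by
  -- The jet (h, H) embeds H¹(Ω) into a separable L² space, and subsets of separable metric spaces
  -- are separable.
  let J : Type := {q : (E N → ℝ) × (E N → E N) // IsH1 Ω q.1 q.2}
  let ι : J → Lp (WithLp 2 (ℝ × E N)) 2 (space Ω) := fun q => (q.2.memLp_jet).toLp
  have : Fact ((2 : ℝ≥0∞) ≠ ∞) := ⟨by simp⟩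
  have : IsSeparable (space Ω) := by unfold space; infer_instance
  have : FiniteDimensional ℝ (WithLp 2 (ℝ × E N)) := inferInstance
  have : ProperSpace (WithLp 2 (ℝ × E N)) := FiniteDimensional.proper_real _
  obtain ⟨c, hcs, hcc, hcd⟩ := (TopologicalSpace.IsSeparable.of_separableSpace
    (range ι)).exists_countable_dense_subset
  have hz : ι ⟨(0, 0), isH1_zero Ω⟩ ∈ closure c := hcd (mem_range_self _)
  have hne : c.Nonempty := closure_nonempty_iff.1 ⟨_, hz⟩
  obtain ⟨e, rfl⟩ := hcc.exists_eq_range hne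
  choose q hq using fun n => hcs (mem_range_self n)
  refine ⟨fun n => (q n).1, fun n => (q n).2, fun h H hh => ?_⟩
  have hmem : ι ⟨(h, H), hh⟩ ∈ closure (range e) := hcd (mem_range_self _)
  obtain ⟨x, hx, hlim⟩ := mem_closure_iff_seq_limit.1 hmem
  choose k hk using hx
  refine ⟨k, ?_⟩
  have hl := Lp.tendsto_Lp_iff_tendsto_eLpNorm'' _ _ _ _ |>.1
    (show Tendsto (fun n => ((q (k n)).2.memLp_jet).toLp) atTop (𝓝 (hh.memLp_jet.toLp)) from by
      refine hlim.congr fun n => ?_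
      rw [← hk n, ← hq (k n)])
  exact hl

/-- Integrated form of the weak time derivative, for a fixed spatial test function. -/
theorem HasTimeDeriv.exists_const {Ω : Set (E N)} {T : ℝ} [IsFiniteMeasure (space Ω)] (hT : 0 < T)
    {y f : E N × ℝ → ℝ} {F : E N × ℝ → E N} (hy : MemLp y 2 (cyl Ω T))
    (hd : HasTimeDeriv Ω T y f F) {h : E N → ℝ} {H : E N → E N} (hh : IsH1 Ω h H) :
    ∃ c, ∀ᵐ t ∂(time T), ∫ x, y (x, t) * h x ∂(space Ω)
      = c + ∫ s in (0 : ℝ)..t, ∫ x, inner ℝ (jet f F (x, s)) (jet h H x) ∂(space Ω) := by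
  have hyh : Integrable (fun z : E N × ℝ => y z * h z.1) (cyl Ω T) :=
    hy.integrable_mul (hh.1.comp_fst (time T))
  have hk : Integrable (fun z : E N × ℝ => inner ℝ (jet f F z) (jet h H z.1)) (cyl Ω T) :=
    integrable_inner_of_memLp (memLp_jet hd.1 hd.2.1) (hh.memLp_jet.comp_fst (time T))
  refine ae_eq_const_add_integral hT hyh.integral_prod_right hk.integral_prod_right ?_
  intro φ hφ hc hs
  have hbd : ∀ ψ : ℝ → ℝ, Continuous ψ → HasCompactSupport ψ → ∀ f : E N × ℝ → ℝ,
      Integrable f (cyl Ω T) → Integrable (fun z => f z * ψ z.2) (cyl Ω T) := by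
    intro ψ hψ hc f hf
    obtain ⟨C, hC⟩ := hψ.bounded_above_of_compact_support hc
    exact hf.mul_bdd (hψ.comp continuous_snd).aestronglyMeasurable (ae_of_all _ fun z => hC z.2)
  have key := hd.2.2 φ hφ hc hs h H hh
  have e1 : ∫ z, y z * deriv φ z.2 * h z.1 ∂(cyl Ω T)
      = ∫ t, (∫ x, y (x, t) * h x ∂(space Ω)) * deriv φ t ∂(time T) := by
    have : ∀ z : E N × ℝ, y z * deriv φ z.2 * h z.1 = y z * h z.1 * deriv φ z.2 := fun z => by ring
    simp only [this]
    rw [cyl, integral_prod_symm _ (hbd _ (hφ.continuous_deriv (by simp)) hc.deriv _ hyh)]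
    simp only [integral_mul_const]
  have e2 : ∫ z, (f z * h z.1 + inner ℝ (F z) (H z.1)) * φ z.2 ∂(cyl Ω T)
      = ∫ t, (∫ x, inner ℝ (jet f F (x, t)) (jet h H x) ∂(space Ω)) * φ t ∂(time T) := by
    simp only [← inner_jet f F h H]
    rw [cyl, integral_prod_symm _ (hbd _ hφ.continuous hc _ hk)]
    simp only [integral_mul_const]
  rw [← e1, ← e2]
  exact key

theorem integrable_pairing {Ω : Set (E N)} {T : ℝ} [IsFiniteMeasure (space Ω)]
    {f : E N × ℝ → ℝ} {F : E N × ℝ → E N} (hf : MemLp f 2 (cyl Ω T)) (hF : MemLp F 2 (cyl Ω T))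
    {h : E N → ℝ} {H : E N → E N} (hh : IsH1 Ω h H) :
    Integrable (fun s => ∫ x, inner ℝ (jet f F (x, s)) (jet h H x) ∂(space Ω)) (time T) :=
  (integrable_inner_of_memLp (memLp_jet hf hF)
    (hh.memLp_jet.comp_fst (time T))).integral_prod_right

theorem intervalIntegrable_pairing {Ω : Set (E N)} {T : ℝ} [IsFiniteMeasure (space Ω)]
    {f : E N × ℝ → ℝ} {F : E N × ℝ → E N} (hf : MemLp f 2 (cyl Ω T)) (hF : MemLp F 2 (cyl Ω T))
    {h : E N → ℝ} {H : E N → E N} (hh : IsH1 Ω h H) {a b : ℝ} (ha : a ∈ Icc 0 T)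
    (hb : b ∈ Icc 0 T) :
    IntervalIntegrable (fun s => ∫ x, inner ℝ (jet f F (x, s)) (jet h H x) ∂(space Ω))
      volume a b := by
  have h0 : IntervalIntegrable (fun s => ∫ x, inner ℝ (jet f F (x, s)) (jet h H x) ∂(space Ω))
      volume 0 T := by
    rw [intervalIntegrable_iff_integrableOn_Ioo_of_le (ha.1.trans ha.2)]
    exact integrable_pairing hf hF hh
  refine h0.mono_set ?_
  rw [uIcc_of_le (ha.1.trans ha.2)]
  exact ordConnected_Icc.uIcc_subset ha hb

/-- For a continuous function with zero initial value the integrated form of the weak time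
derivative holds at every time. -/
theorem HasTimeDeriv.integral_mul_eq_of_continuousOn {Ω : Set (E N)} {T : ℝ} (hΩ : IsOpen Ω)
    (hbd : Bornology.IsBounded Ω) [IsFiniteMeasure (space Ω)] (hT : 0 < T)
    {y f : E N × ℝ → ℝ} {F : E N × ℝ → E N} (hy : MemLp y 2 (cyl Ω T))
    (hyc : ContinuousOn y (closure Ω ×ˢ Icc 0 T)) (hy0 : ∀ x ∈ closure Ω, y (x, 0) = 0)
    (hd : HasTimeDeriv Ω T y f F) {h : E N → ℝ} {H : E N → E N} (hh : IsH1 Ω h H)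
    {t : ℝ} (ht : t ∈ Icc 0 T) :
    ∫ x, y (x, t) * h x ∂(space Ω)
      = ∫ s in (0 : ℝ)..t, ∫ x, inner ℝ (jet f F (x, s)) (jet h H x) ∂(space Ω) := by
  obtain ⟨c, hc⟩ := hd.exists_const hT hy hh
  have hcpt : IsCompact (closure Ω ×ˢ Icc 0 T) := hbd.isCompact_closure.prod isCompact_Icc
  obtain ⟨C, hC⟩ := hcpt.exists_bound_of_continuousOn hyc
  have hmem : ∀ᵐ x ∂(space Ω), x ∈ Ω := ae_restrict_mem hΩ.measurableSet
  have hcont : ContinuousOn (fun t => ∫ x, y (x, t) * h x ∂(space Ω)) (Icc 0 T) := by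
    refine continuousOn_of_dominated (bound := fun x => C * ‖h x‖) (fun t ht => ?_)
      (fun t ht => ?_) ((hh.1.integrable (by norm_num)).norm.const_mul C) ?_
    · refine AEStronglyMeasurable.mul ?_ hh.1.1
      refine ContinuousOn.aestronglyMeasurable ?_ hΩ.measurableSet
      exact hyc.comp (by fun_prop) fun x hx => ⟨subset_closure hx, ht⟩
    · filter_upwards [hmem] with x hx
      rw [norm_mul]
      exact mul_le_mul_of_nonneg_right (hC _ ⟨subset_closure hx, ht⟩) (norm_nonneg _)
    · filter_upwards [hmem] with x hx
      exact (hyc.comp (by fun_prop) fun t ht => ⟨subset_closure hx, ht⟩).mul continuousOn_const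
  have hk := intervalIntegrable_pairing hd.1 hd.2.1 hh (left_mem_Icc.2 hT.le)
    (right_mem_Icc.2 hT.le)
  have hcont2 : ContinuousOn (fun t => c + ∫ s in (0 : ℝ)..t,
      ∫ x, inner ℝ (jet f F (x, s)) (jet h H x) ∂(space Ω)) (Icc 0 T) := by
    have := intervalIntegral.continuousOn_primitive_interval' hk left_mem_uIcc
    rw [uIcc_of_le hT.le] at this
    exact continuousOn_const.add this
  -- Both sides are continuous in time, so equality almost everywhere becomes equality on [0,T];
  -- evaluation at 0 then shows that the constant vanishes.
  have heq := Measure.eqOn_Icc_of_ae_eq (μ := volume) hT.ne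
    (by rw [← Measure.restrict_congr_set Ioo_ae_eq_Icc]; exact hc) hcont hcont2
  have h0 := heq (left_mem_Icc.2 hT.le)
  have hz : ∫ x, y (x, 0) * h x ∂(space Ω) = 0 := by
    refine integral_eq_zero_of_ae ?_
    filter_upwards [hmem] with x hx
    change y (x, 0) * h x = 0
    rw [hy0 x (subset_closure hx), zero_mul]
  simp only [intervalIntegral.integral_same, add_zero] at h0
  rw [hz] at h0
  have := heq ht
  simp only [← h0, zero_add] at this
  exact this

/-- Left neighbourhoods of T have positive measure. Without this, the limit in `HasTerminalValue`
would not determine the terminal value. -/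
instance neBot_nhdsWithin_Iio_inf_ae (T : ℝ) : (𝓝[<] T ⊓ ae (volume : Measure ℝ)).NeBot := by
  rw [inf_neBot_iff]
  intro s hs s' hs'
  obtain ⟨a, ha, has⟩ := (mem_nhdsLT_iff_exists_Ioo_subset (a := T)).1 hs
  have hpos : 0 < volume (Ioo a T) := by simpa using ha
  by_contra hne
  have hsub : Ioo a T ⊆ s'ᶜ := fun x hx hx' => hne ⟨x, has hx, hx'⟩
  exact hpos.ne' (measure_mono_null hsub (mem_ae_iff.1 hs'))

/-- Integrated form of the weak time derivative up to the terminal time. For almost every time it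
holds with all spatial test functions simultaneously. -/
theorem HasTimeDeriv.ae_integral_sub_mul_eq {Ω : Set (E N)} {T : ℝ}
    [IsFiniteMeasure (space Ω)] (hT : 0 < T)
    {p f : E N × ℝ → ℝ} {F : E N × ℝ → E N} {g : E N → ℝ} (hp : MemLp p 2 (cyl Ω T))
    (hd : HasTimeDeriv Ω T p f F) (hg : MemLp g 2 (space Ω)) (hpT : HasTerminalValue Ω T p g) :
    ∀ᵐ t ∂(time T), ∀ h H, IsH1 Ω h H → ∫ x, (g x - p (x, t)) * h x ∂(space Ω)
      = ∫ s in t..T, ∫ x, inner ℝ (jet f F (x, s)) (jet h H x) ∂(space Ω) := by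
  have hslice : ∀ᵐ t ∂(time T), MemLp (fun x => p (x, t)) 2 (space Ω) := ae_memLp_two_slice hp
  have hIoo : ∀ᵐ t ∂(time T), t ∈ Ioo 0 T := ae_restrict_mem measurableSet_Ioo
  have hfilter : ∀ P : ℝ → Prop, (∀ᵐ t ∂(time T), P t) →
      ∀ᶠ t in 𝓝[<] T ⊓ ae (volume : Measure ℝ), P t := by
    intro P hP
    rw [time, ae_restrict_iff' measurableSet_Ioo] at hP
    filter_upwards [mem_inf_of_left (Ioo_mem_nhdsLT hT), mem_inf_of_right hP] with t h1 h2
    exact h2 h1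
  have hone : ∀ h H, IsH1 Ω h H → ∀ᵐ t ∂(time T), ∫ x, (g x - p (x, t)) * h x ∂(space Ω)
      = ∫ s in t..T, ∫ x, inner ℝ (jet f F (x, s)) (jet h H x) ∂(space Ω) := by
    intro h H hh
    obtain ⟨c, hc⟩ := hd.exists_const hT hp hh
    have hk : ∀ {a b}, a ∈ Icc 0 T → b ∈ Icc 0 T → _ := fun {a b} ha hb =>
      intervalIntegrable_pairing hd.1 hd.2.1 hh (a := a) (b := b) ha hb
    have hl1 : Tendsto (fun t => ∫ x, (p (x, t) - g x) * h x ∂(space Ω))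
        (𝓝[<] T ⊓ ae (volume : Measure ℝ)) (𝓝 0) := by
      have h2 := ((ENNReal.tendsto_toReal ENNReal.zero_ne_top).comp hpT).mul_const
        (eLpNorm h 2 (space Ω)).toReal
      simp only [ENNReal.toReal_zero, zero_mul] at h2
      refine squeeze_zero_norm' ?_ h2
      filter_upwards [hfilter _ hslice] with t ht
      have h4 := abs_integral_inner_le (ht.sub hg) hh.1
      simp only [Pi.sub_apply, RCLike.inner_apply, conj_trivial, mul_comm (h _)] at h4
      exact h4
    have hl2 : Tendsto (fun t => ∫ s in (0 : ℝ)..t,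
        ∫ x, inner ℝ (jet f F (x, s)) (jet h H x) ∂(space Ω))
        (𝓝[<] T ⊓ ae (volume : Measure ℝ))
        (𝓝 (∫ s in (0 : ℝ)..T, ∫ x, inner ℝ (jet f F (x, s)) (jet h H x) ∂(space Ω))) := by
      have h2 := intervalIntegral.continuousOn_primitive_interval'
        (hk (left_mem_Icc.2 hT.le) (right_mem_Icc.2 hT.le)) left_mem_uIcc
      rw [uIcc_of_le hT.le] at h2
      have h3 := (h2 T (right_mem_Icc.2 hT.le)).tendsto
      refine h3.mono_left ?_
      refine inf_le_left.trans ?_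
      rw [← nhdsWithin_Ioo_eq_nhdsLT hT]
      exact nhdsWithin_mono _ Ioo_subset_Icc_self
    have hsub : ∀ᵐ t ∂(time T), ∫ x, (p (x, t) - g x) * h x ∂(space Ω)
        = c + (∫ s in (0 : ℝ)..t, ∫ x, inner ℝ (jet f F (x, s)) (jet h H x) ∂(space Ω))
          - ∫ x, g x * h x ∂(space Ω) := by
      filter_upwards [hc, hslice] with t h1 h2
      have h3 : Integrable (fun x => p (x, t) * h x) (space Ω) := h2.integrable_mul hh.1
      have h4 : Integrable (fun x => g x * h x) (space Ω) := hg.integrable_mul hh.1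
      rw [← h1, ← integral_sub h3 h4]
      simp only [sub_mul]
    -- Letting t tend to T identifies the constant: c + ∫₀ᵀ ⟨p_t, h⟩ = ∫ g h.
    have hlim := tendsto_nhds_unique_of_eventuallyEq hl1
      ((hl2.const_add c).sub_const (∫ x, g x * h x ∂(space Ω))) (hfilter _ hsub)
    filter_upwards [hsub, hIoo] with t h1 h2
    have h3 : ∫ x, (g x - p (x, t)) * h x ∂(space Ω)
        = - ∫ x, (p (x, t) - g x) * h x ∂(space Ω) := by
      rw [← integral_neg]
      exact integral_congr_ae (ae_of_all _ fun x => by ring)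
    have ht : t ∈ Icc 0 T := Ioo_subset_Icc_self h2
    have h4 := intervalIntegral.integral_add_adjacent_intervals
      (hk (left_mem_Icc.2 hT.le) ht) (hk ht (right_mem_Icc.2 hT.le))
    rw [h3, h1]
    linarith
  -- The null set in `hone` depends on the test function. A countable dense family yields one null
  -- set for all of H¹(Ω), since both sides are continuous in the H¹ norm.
  obtain ⟨s, hs, hdense⟩ := exists_dense_seq_isH1 Ω
  have hall := ae_all_iff.2 fun n => hone _ _ (hs n)
  filter_upwards [hall, hslice, hIoo] with t h1 h2 h3 h H hh
  obtain ⟨k, hk⟩ := hdense h H hh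
  have hl : Tendsto (fun n => ∫ x, (g x - p (x, t)) * (s (k n)).1 x ∂(space Ω)) atTop
      (𝓝 (∫ x, (g x - p (x, t)) * h x ∂(space Ω))) := by
    have := tendsto_integral_inner (memLp_jet (N := N) (hg.sub h2) (MemLp.zero))
      hh.memLp_jet (fun n => (hs (k n)).memLp_jet) hk
    simpa only [inner_jet, Pi.sub_apply, Pi.zero_apply, inner_zero_left, add_zero] using this
  let τ : Measure ℝ := volume.restrict (Ioo t T)
  have hL : MemLp (jet f F) 2 ((space Ω).prod τ) := by
    refine (memLp_jet hd.1 hd.2.1).mono_measure ?_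
    exact Measure.prod_mono le_rfl (Measure.restrict_mono (Ioo_subset_Ioo_left h3.1.le) le_rfl)
  have hτ : ∀ (h : E N → ℝ) (H : E N → E N), IsH1 Ω h H →
      ∫ s in t..T, ∫ x, inner ℝ (jet f F (x, s)) (jet h H x) ∂(space Ω)
        = ∫ z, inner ℝ (jet f F z) (jet h H z.1) ∂((space Ω).prod τ) := by
    intro h H hh
    rw [integral_prod_symm _ (integrable_inner_of_memLp hL (hh.memLp_jet.comp_fst τ)),
      intervalIntegral.integral_of_le h3.2.le, integral_Ioc_eq_integral_Ioo]
  have hr : Tendsto (fun n => ∫ r in t..T,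
      ∫ x, inner ℝ (jet f F (x, r)) (jet (s (k n)).1 (s (k n)).2 x) ∂(space Ω)) atTop
      (𝓝 (∫ r in t..T, ∫ x, inner ℝ (jet f F (x, r)) (jet h H x) ∂(space Ω))) := by
    rw [hτ h H hh]
    simp only [fun n => hτ _ _ (hs (k n))]
    refine tendsto_integral_inner hL (hh.memLp_jet.comp_fst τ)
      (fun n => (hs (k n)).memLp_jet.comp_fst τ) ?_
    have h5 := tendsto_eLpNorm_comp_fst (τ := τ)
      (G := fun n => jet (s (k n)).1 (s (k n)).2 - jet h H)
      (fun n => ((hs (k n)).memLp_jet.sub hh.memLp_jet).aestronglyMeasurable) hk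
    exact h5
  refine tendsto_nhds_unique hl (hr.congr fun n => (h1 (k n)).symm)

end ParabolicControl

/-! ### Integration by parts in time -/

namespace ParabolicControl

variable {N : ℕ}

/-- Extension by zero outside the time interval `(0,T)`. -/
noncomputable def zeroExt {V : Type*} [Zero V] (T : ℝ) (f : E N × ℝ → V) : E N × ℝ → V :=
  (univ ×ˢ Ioo 0 T).indicator f

theorem zeroExt_of_mem {V : Type*} [Zero V] {T t : ℝ} (ht : t ∈ Ioo 0 T) (f : E N × ℝ → V)
    (x : E N) : zeroExt T f (x, t) = f (x, t) :=
  indicator_of_mem (s := univ ×ˢ Ioo 0 T) ⟨mem_univ _, ht⟩ f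

theorem zeroExt_of_notMem {V : Type*} [Zero V] {T t : ℝ} (ht : t ∉ Ioo 0 T) (f : E N × ℝ → V)
    (x : E N) : zeroExt T f (x, t) = 0 :=
  indicator_of_notMem (fun h => ht h.2) f

theorem cyl_eq_restrict (Ω : Set (E N)) (T : ℝ) :
    cyl Ω T = ((space Ω).prod volume).restrict (univ ×ˢ Ioo 0 T) := by
  unfold cyl space time
  rw [← Measure.prod_restrict, Measure.restrict_univ]

theorem memLp_zeroExt {V : Type*} [NormedAddCommGroup V] {Ω : Set (E N)} {T : ℝ}
    {f : E N × ℝ → V} (hf : MemLp f 2 (cyl Ω T)) :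
    MemLp (zeroExt T f) 2 ((space Ω).prod volume) := by
  rw [cyl_eq_restrict] at hf
  exact (memLp_indicator_iff_restrict (MeasurableSet.univ.prod measurableSet_Ioo)).2 hf

theorem integral_inner_zeroExt {V : Type*} [NormedAddCommGroup V] [InnerProductSpace ℝ V]
    {Ω : Set (E N)} {T : ℝ} (f g : E N × ℝ → V) :
    ∫ z, inner ℝ (zeroExt T f z) (zeroExt T g z) ∂((space Ω).prod volume)
      = ∫ z, inner ℝ (f z) (g z) ∂(cyl Ω T) := by
  rw [cyl_eq_restrict, ← integral_indicator (MeasurableSet.univ.prod measurableSet_Ioo)]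
  refine integral_congr_ae (ae_of_all _ fun z => ?_)
  by_cases hz : z ∈ (univ : Set (E N)) ×ˢ Ioo 0 T
  · simp [zeroExt, hz]
  · simp [zeroExt, hz]

/-- A continuous function whose integrals over short intervals to the right of `0` vanish is zero
at `0`. -/
theorem eq_zero_of_intervalIntegral_eq_zero {T : ℝ} (hT : 0 < T) {κ : ℝ → ℝ}
    (hκ : ContinuousOn κ (Icc 0 T)) (h : ∀ ε ∈ Ioo 0 T, ∫ σ in (0 : ℝ)..ε, κ σ = 0) :
    κ 0 = 0 := by
  -- The primitive has right derivative κ(0) at 0, and also 0 because it vanishes near 0 on the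
  -- right.
  have h1 : HasDerivWithinAt (fun u => ∫ σ in (0 : ℝ)..u, κ σ) (κ 0) (Ici 0) 0 := by
    refine intervalIntegral.integral_hasDerivWithinAt_right (t := Ioi 0) (by simp) ?_ ?_
    · exact ⟨Ioo 0 T, Ioo_mem_nhdsGT hT,
        (hκ.mono Ioo_subset_Icc_self).aestronglyMeasurable measurableSet_Ioo⟩
    · have := (hκ 0 (left_mem_Icc.2 hT.le)).mono (Ioo_subset_Icc_self)
      rwa [ContinuousWithinAt, nhdsWithin_Ioo_eq_nhdsGT hT] at this
  have h2 : HasDerivWithinAt (fun u => ∫ σ in (0 : ℝ)..u, κ σ) 0 (Ici 0) 0 := by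
    refine (hasDerivWithinAt_const (0 : ℝ) (Ici 0) (0 : ℝ)).congr_of_eventuallyEq ?_ (by simp)
    filter_upwards [Ico_mem_nhdsGE hT] with u hu
    rcases hu.1.eq_or_lt with rfl | h0
    · simp
    · exact h u ⟨h0, hu.2⟩
  exact (uniqueDiffWithinAt_Ici (0 : ℝ)).eq_deriv _ h1 h2

theorem intervalIntegral_indicator_Ioo_left {T t ε : ℝ} (ht : t ∈ Ioo 0 T) (hε : 0 < ε) (k : ℝ → ℝ) :
    ∫ s in (t - ε)..t, (Ioo 0 T).indicator k s = ∫ s in (max (t - ε) 0)..t, k s := by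
  have h1 : max (t - ε) 0 ≤ t := max_le (by linarith) ht.1.le
  rw [intervalIntegral.integral_of_le (by linarith), intervalIntegral.integral_of_le h1,
    setIntegral_indicator measurableSet_Ioo]
  congr 2
  ext s
  simp only [mem_inter_iff, mem_Ioc, mem_Ioo, max_lt_iff]
  constructor
  · rintro ⟨⟨a, b⟩, c, d⟩; exact ⟨⟨a, c⟩, b⟩
  · rintro ⟨⟨a, c⟩, b⟩; exact ⟨⟨a, b⟩, c, b.trans_lt ht.2⟩

theorem intervalIntegral_indicator_Ioo_right {T t ε : ℝ} (ht : t ∈ Ioo 0 T) (hε : 0 < ε) (k : ℝ → ℝ) :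
    ∫ s in t..(t + ε), (Ioo 0 T).indicator k s = ∫ s in t..(min (t + ε) T), k s := by
  have h1 : t ≤ min (t + ε) T := le_min (by linarith) ht.2.le
  rw [intervalIntegral.integral_of_le (by linarith), intervalIntegral.integral_of_le h1,
    integral_Ioc_eq_integral_Ioo, integral_Ioc_eq_integral_Ioo,
    setIntegral_indicator measurableSet_Ioo]
  congr 2
  ext s
  simp only [mem_inter_iff, mem_Ioo, lt_min_iff]
  constructor
  · rintro ⟨⟨a, b⟩, c, d⟩; exact ⟨a, b, d⟩
  · rintro ⟨a, b, d⟩; exact ⟨⟨a, b⟩, ht.1.trans a, d⟩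

theorem IsL2H1.ae_isH1 {Ω : Set (E N)} {T : ℝ} [IsFiniteMeasure (space Ω)] {w : E N × ℝ → ℝ}
    {W : E N × ℝ → E N} (hw : IsL2H1 Ω T w W) :
    ∀ᵐ t ∂(time T), IsH1 Ω (fun x => w (x, t)) (fun x => W (x, t)) := by
  filter_upwards [ae_memLp_two_slice (μ := space Ω) (ν := time T) hw.1,
    ae_memLp_two_slice (μ := space Ω) (ν := time T) hw.2.1, hw.2.2] with t h1 h2 h3
  exact ⟨h1, h2, h3⟩

section Parts

variable {Ω : Set (E N)} {T : ℝ}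

theorem integral_inner_zeroExt_slice (f : E N × ℝ → ℝ) (F : E N × ℝ → E N) (w : E N × ℝ → ℝ)
    (W : E N × ℝ → E N) {t : ℝ} (ht : t ∈ Ioo 0 T) (s : ℝ) :
    ∫ x, inner ℝ (zeroExt T (jet f F) (x, s)) (zeroExt T (jet w W) (x, t)) ∂(space Ω)
      = (Ioo 0 T).indicator (fun s => ∫ x, inner ℝ (jet f F (x, s))
          (jet (fun x => w (x, t)) (fun x => W (x, t)) x) ∂(space Ω)) s := by
  by_cases hs : s ∈ Ioo 0 T
  · simp only [zeroExt_of_mem ht, zeroExt_of_mem hs, indicator_of_mem hs]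
    rfl
  · simp [zeroExt_of_notMem hs, indicator_of_notMem hs]

/-- The `L²(Ω)` pairing of `p` at time `s` with `y` at time `t`, both extended by zero in time. -/
noncomputable def slicePairing (Ω : Set (E N)) (T : ℝ) (p y : E N × ℝ → ℝ) (s t : ℝ) : ℝ :=
  ∫ x, zeroExt T p (x, s) * zeroExt T y (x, t) ∂(space Ω)

theorem slicePairing_of_mem {p y : E N × ℝ → ℝ} {s t : ℝ} (hs : s ∈ Ioo 0 T) (ht : t ∈ Ioo 0 T) :
    slicePairing Ω T p y s t = ∫ x, p (x, s) * y (x, t) ∂(space Ω) := by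
  simp only [slicePairing, zeroExt_of_mem hs, zeroExt_of_mem ht]

theorem slicePairing_of_notMem_left {p y : E N × ℝ → ℝ} {s t : ℝ} (hs : s ∉ Ioo 0 T) :
    slicePairing Ω T p y s t = 0 := by
  simp [slicePairing, zeroExt_of_notMem hs]

theorem slicePairing_of_notMem_right {p y : E N × ℝ → ℝ} {s t : ℝ} (ht : t ∉ Ioo 0 T) :
    slicePairing Ω T p y s t = 0 := by
  simp [slicePairing, zeroExt_of_notMem ht]

variable [IsFiniteMeasure (space Ω)]

theorem integrable_slicePairing {p y : E N × ℝ → ℝ} (hp : MemLp p 2 (cyl Ω T))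
    (hy : MemLp y 2 (cyl Ω T)) (ε : ℝ) :
    Integrable (fun t => slicePairing Ω T p y (t + ε) t) := by
  have h1 := (memLp_zeroExt hp).comp_measurePreserving (measurePreserving_translate (space Ω) ε)
  exact (h1.integrable_mul (memLp_zeroExt hy)).integral_prod_right

/-- Correlation identity for a function with zero initial value. -/
theorem ae_integral_shift_back (hΩ : IsOpen Ω) (hbd : Bornology.IsBounded Ω) (hT : 0 < T)
    {y d p : E N × ℝ → ℝ} {F P : E N × ℝ → E N} (hy : MemLp y 2 (cyl Ω T))
    (hyc : ContinuousOn y (closure Ω ×ˢ Icc 0 T)) (hy0 : ∀ x ∈ closure Ω, y (x, 0) = 0)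
    (hd : HasTimeDeriv Ω T y d F) (hp : IsL2H1 Ω T p P) {ε : ℝ} (hε : 0 < ε) :
    ∀ᵐ t, ∫ s in (t - ε)..t, ∫ x, inner ℝ (zeroExt T (jet d F) (x, s))
        (zeroExt T (jet p P) (x, t)) ∂(space Ω)
      = slicePairing Ω T p y t t - slicePairing Ω T p y t (t - ε) := by
  have hH1 := hp.ae_isH1
  rw [time, ae_restrict_iff' measurableSet_Ioo] at hH1
  filter_upwards [hH1] with t hh
  by_cases ht : t ∈ Ioo 0 T
  swap
  · simp [zeroExt_of_notMem ht, slicePairing_of_notMem_left ht]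
  replace hh := hh ht
  have hI : ∀ {a b}, a ∈ Icc 0 T → b ∈ Icc 0 T → _ := fun {a b} ha hb =>
    intervalIntegrable_pairing hd.1 hd.2.1 hh (a := a) (b := b) ha hb
  have hval : ∀ s ∈ Ioo 0 T, slicePairing Ω T p y t s = ∫ r in (0 : ℝ)..s,
      ∫ x, inner ℝ (jet d F (x, r)) (jet (fun x => p (x, t)) (fun x => P (x, t)) x)
        ∂(space Ω) := fun s hs => by
    rw [slicePairing_of_mem ht hs]
    simp only [mul_comm (p _)]
    exact hd.integral_mul_eq_of_continuousOn hΩ hbd hT hy hyc hy0 hh (Ioo_subset_Icc_self hs)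
  simp only [integral_inner_zeroExt_slice d F p P ht]
  rw [intervalIntegral_indicator_Ioo_left ht hε, hval t ht]
  have h0 : (0 : ℝ) ∈ Icc 0 T := left_mem_Icc.2 hT.le
  -- For t ≤ ε the integral is clipped at 0 and gives y(t) - y(0). As y(0) = 0, this agrees with the
  -- zero extension, so no boundary term arises.
  rcases le_or_gt (t - ε) 0 with hle | hlt
  · rw [slicePairing_of_notMem_right (fun h => absurd h.1 hle.not_gt), max_eq_right hle, sub_zero]
  · have hmem : t - ε ∈ Ioo 0 T := ⟨hlt, by linarith [ht.2]⟩
    rw [hval _ hmem, max_eq_left hlt.le, intervalIntegral.integral_interval_sub_left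
      (hI h0 (Ioo_subset_Icc_self ht)) (hI h0 (Ioo_subset_Icc_self hmem))]

/-- Correlation identity for a function with a terminal value. -/
theorem ae_integral_shift_forward (hT : 0 < T)
    {p d y : E N × ℝ → ℝ} {F Y : E N × ℝ → E N} {g : E N → ℝ} (hp : MemLp p 2 (cyl Ω T))
    (hd : HasTimeDeriv Ω T p d F) (hg : MemLp g 2 (space Ω)) (hpT : HasTerminalValue Ω T p g)
    (hy : IsL2H1 Ω T y Y) {ε : ℝ} (hε : 0 < ε) :
    ∀ᵐ t, ∫ s in t..(t + ε), ∫ x, inner ℝ (zeroExt T (jet d F) (x, s))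
        (zeroExt T (jet y Y) (x, t)) ∂(space Ω)
      = (Ico (T - ε) T).indicator
          (fun t => slicePairing Ω T (fun z => g z.1) y t t) t
        - slicePairing Ω T p y t t + slicePairing Ω T p y (t + ε) t := by
  have hH1 := hy.ae_isH1
  have hid := hd.ae_integral_sub_mul_eq hT hp hg hpT
  have hsl : ∀ᵐ t ∂(time T), MemLp (fun x => p (x, t)) 2 (space Ω) := ae_memLp_two_slice hp
  rw [time, ae_restrict_iff' measurableSet_Ioo] at hH1 hid hsl
  -- Shifts preserve null sets, so the almost-everywhere identities are available at t + ε as well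
  -- as at t.
  have hq := (measurePreserving_add_right (volume : Measure ℝ) ε).quasiMeasurePreserving
  filter_upwards [hH1, hid, hsl, hq.ae hid, hq.ae hsl] with t hh hidt hslt hide hsle
  by_cases ht : t ∈ Ioo 0 T
  swap
  · simp [zeroExt_of_notMem ht, slicePairing_of_notMem_right ht, indicator]
  replace hh := hh ht
  have hI : ∀ {a b}, a ∈ Icc 0 T → b ∈ Icc 0 T → _ := fun {a b} ha hb =>
    intervalIntegrable_pairing hd.1 hd.2.1 hh (a := a) (b := b) ha hb
  have hT' : T ∈ Icc 0 T := right_mem_Icc.2 hT.le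
  have hsplit : ∀ s ∈ Ioo 0 T, MemLp (fun x => p (x, s)) 2 (space Ω) →
      ∫ x, (g x - p (x, s)) * y (x, t) ∂(space Ω)
        = slicePairing Ω T (fun z => g z.1) y t t - slicePairing Ω T p y s t := by
    intro s hs hps
    have h1 : Integrable (fun x => g x * y (x, t)) (space Ω) := hg.integrable_mul hh.1
    have h2 : Integrable (fun x => p (x, s) * y (x, t)) (space Ω) := hps.integrable_mul hh.1
    rw [slicePairing_of_mem ht ht, slicePairing_of_mem hs ht, ← integral_sub h1 h2]
    simp only [sub_mul]
  simp only [integral_inner_zeroExt_slice d F y Y ht]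
  rw [intervalIntegral_indicator_Ioo_right ht hε]
  have e1 := hidt ht _ _ hh
  rw [hsplit t ht (hslt ht)] at e1
  -- Once t + ε reaches T, the integral stops at T and g replaces p(t + ε); this is the source of
  -- the indicator term.
  rcases le_or_gt T (t + ε) with hle | hlt
  · rw [min_eq_right hle, slicePairing_of_notMem_left fun h => absurd h.2 hle.not_gt,
      indicator_of_mem (show t ∈ Ico (T - ε) T from ⟨by linarith, ht.2⟩), ← e1, add_zero]
  · have hmem : t + ε ∈ Ioo 0 T := ⟨by linarith [ht.1], hlt⟩
    have e2 := hide hmem _ _ hh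
    rw [hsplit _ hmem (hsle hmem)] at e2
    have e3 := intervalIntegral.integral_add_adjacent_intervals
      (hI (Ioo_subset_Icc_self ht) (Ioo_subset_Icc_self hmem)) (hI (Ioo_subset_Icc_self hmem) hT')
    rw [min_eq_left hlt.le, indicator_of_notMem fun h => by linarith [h.1]]
    linarith

/-- Integration by parts in time for a continuous `y ∈ W(0,T)` with zero initial value and a
`p ∈ W(0,T)` with terminal value `g`. -/
theorem integral_timeDeriv_add_integral_timeDeriv (hΩ : IsOpen Ω) (hbd : Bornology.IsBounded Ω)
    (hT : 0 < T) {y d p d' : E N × ℝ → ℝ} {Y F P F' : E N × ℝ → E N} {g : E N → ℝ}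
    (hy : IsL2H1 Ω T y Y) (hyc : ContinuousOn y (closure Ω ×ˢ Icc 0 T))
    (hy0 : ∀ x ∈ closure Ω, y (x, 0) = 0) (hd : HasTimeDeriv Ω T y d F)
    (hp : IsL2H1 Ω T p P) (hd' : HasTimeDeriv Ω T p d' F') (hg : MemLp g 2 (space Ω))
    (hpT : HasTerminalValue Ω T p g) :
    ∫ z, (d z * p z + inner ℝ (F z) (P z)) ∂(cyl Ω T)
      + ∫ z, (d' z * y z + inner ℝ (F' z) (Y z)) ∂(cyl Ω T)
      = ∫ x, g x * y (x, T) ∂(space Ω) := by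
  let ν := (space Ω).prod (volume : Measure ℝ)
  have hL : MemLp (zeroExt T (jet d F)) 2 ν := memLp_zeroExt (memLp_jet hd.1 hd.2.1)
  have hM : MemLp (zeroExt T (jet d' F')) 2 ν := memLp_zeroExt (memLp_jet hd'.1 hd'.2.1)
  have hP : MemLp (zeroExt T (jet p P)) 2 ν := memLp_zeroExt (memLp_jet hp.1 hp.2.1)
  have hY : MemLp (zeroExt T (jet y Y)) 2 ν := memLp_zeroExt (memLp_jet hy.1 hy.2.1)
  let c₁ : ℝ → ℝ := fun σ =>
    ∫ z, inner ℝ (zeroExt T (jet d F) (z.1, z.2 + σ)) (zeroExt T (jet p P) z) ∂ν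
  let c₂ : ℝ → ℝ := fun σ =>
    ∫ z, inner ℝ (zeroExt T (jet d' F') (z.1, z.2 + σ)) (zeroExt T (jet y Y) z) ∂ν
  have hc₁ : Continuous c₁ := continuous_integral_inner_translate hL hP
  have hc₂ : Continuous c₂ := continuous_integral_inner_translate hM hY
  let γ : ℝ → ℝ := fun t => ∫ x, g x * y (x, t) ∂(space Ω)
  have hγ : ContinuousOn γ (Icc 0 T) := by
    have hcpt : IsCompact (closure Ω ×ˢ Icc 0 T) := hbd.isCompact_closure.prod isCompact_Icc
    obtain ⟨C, hC⟩ := hcpt.exists_bound_of_continuousOn hyc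
    have hmem : ∀ᵐ x ∂(space Ω), x ∈ Ω := ae_restrict_mem hΩ.measurableSet
    refine continuousOn_of_dominated (bound := fun x => ‖g x‖ * C) (fun t ht => ?_)
      (fun t ht => ?_) ((hg.integrable (by norm_num)).norm.mul_const C) ?_
    · refine hg.1.mul ?_
      refine ContinuousOn.aestronglyMeasurable ?_ hΩ.measurableSet
      exact hyc.comp (by fun_prop) fun x hx => ⟨subset_closure hx, ht⟩
    · filter_upwards [hmem] with x hx
      rw [norm_mul]
      exact mul_le_mul_of_nonneg_left (hC _ ⟨subset_closure hx, ht⟩) (norm_nonneg _)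
    · filter_upwards [hmem] with x hx
      exact continuousOn_const.mul
        (hyc.comp (by fun_prop) fun t ht => ⟨subset_closure hx, ht⟩)
  -- Its value at σ = 0 is the defect in the claimed identity. The opposite shifts and the argument
  -- T - σ are chosen so that the integral over (0,ε) telescopes to zero.
  have hκ : ContinuousOn (fun σ => c₁ (-σ) + c₂ σ - γ (T - σ)) (Icc 0 T) := by
    refine ((hc₁.comp continuous_neg).add hc₂).continuousOn.sub ?_
    refine hγ.comp (by fun_prop) fun σ hσ => ⟨by linarith [hσ.2], by linarith [hσ.1]⟩
  have hzero := eq_zero_of_intervalIntegral_eq_zero hT hκ ?_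
  · simp only [neg_zero, sub_zero, c₁, c₂, add_zero, Prod.mk.eta, ν,
      integral_inner_zeroExt, inner_jet] at hzero
    exact sub_eq_zero.1 hzero
  rintro ε ⟨hε, hεT⟩
  have hγi : IntervalIntegrable (fun σ => γ (T - σ)) volume 0 ε := by
    refine ContinuousOn.intervalIntegrable ?_
    rw [uIcc_of_le hε.le]
    exact hγ.comp (by fun_prop) fun σ hσ => ⟨by linarith [hσ.2], by linarith [hσ.1]⟩
  have hc₁n : Continuous fun σ => c₁ (-σ) := hc₁.comp continuous_neg
  have hc₁₂ : Continuous fun σ => c₁ (-σ) + c₂ σ := hc₁n.add hc₂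
  rw [intervalIntegral.integral_sub (hc₁₂.intervalIntegrable _ _) hγi,
    intervalIntegral.integral_add (hc₁n.intervalIntegrable _ _) (hc₂.intervalIntegrable _ _),
    intervalIntegral.integral_comp_neg, intervalIntegral.integral_comp_sub_left, sub_zero,
    neg_zero, intervalIntegral_integral_inner_translate hL hP (by linarith),
    intervalIntegral_integral_inner_translate hM hY hε.le]
  simp only [add_zero, ← sub_eq_add_neg]
  have hr := integrable_slicePairing hp.1 hy.1 0
  simp only [add_zero] at hr
  have hq := integrable_slicePairing hp.1 hy.1 ε
  have hq' : Integrable fun t => slicePairing Ω T p y t (t - ε) := by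
    have := hq.comp_sub_right ε
    simpa using this
  have hG := integrable_slicePairing (hg.comp_fst (time T)) hy.1 0
  simp only [add_zero] at hG
  -- Translation invariance on the whole line, which the zero extensions make available, cancels the
  -- two cross terms.
  have hqq : ∫ t, slicePairing Ω T p y t (t - ε) = ∫ t, slicePairing Ω T p y (t + ε) t := by
    rw [← integral_sub_right_eq_self (fun t => slicePairing Ω T p y (t + ε) t) ε]
    simp
  let G : ℝ → ℝ := fun t => slicePairing Ω T (fun z => g z.1) y t t
  have hGi : Integrable ((Ico (T - ε) T).indicator G) := hG.indicator measurableSet_Ico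
  have hGr : Integrable fun t => (Ico (T - ε) T).indicator G t - slicePairing Ω T p y t t :=
    hGi.sub hr
  rw [integral_congr_ae (ae_integral_shift_back hΩ hbd hT hy.1 hyc hy0 hd hp hε),
    integral_congr_ae (ae_integral_shift_forward hT hp.1 hd' hg hpT hy hε),
    integral_sub hr hq',
    integral_add hGr hq, integral_sub hGi hr, hqq,
    integral_indicator measurableSet_Ico, intervalIntegral.integral_of_le (by linarith),
    integral_Ioc_eq_integral_Ioo, ← integral_Ico_eq_integral_Ioo,
    setIntegral_congr_fun (g := γ) measurableSet_Ico fun t ht =>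
      have ht' : t ∈ Ioo 0 T := ⟨by linarith [ht.1], ht.2⟩
      slicePairing_of_mem ht' ht']
  ring

end Parts

end ParabolicControl

/-! ### Differences of states, variational inequalities and duality -/

namespace ParabolicControl

variable {N : ℕ}

/-- The L² bounds in `IsH1` supply the integrability needed to split the integrals; the weak
gradient identity alone does not. -/
theorem HasWeakGrad.sub {Ω : Set (E N)} {f₁ f₂ : E N → ℝ} {F₁ F₂ : E N → E N}
    (h₁ : IsH1 Ω f₁ F₁) (h₂ : IsH1 Ω f₂ F₂) : HasWeakGrad Ω (f₁ - f₂) (F₁ - F₂) := by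
  intro φ hφ hc hs i
  have : IsFiniteMeasureOnCompacts (space Ω) := by unfold space; infer_instance
  have hφ2 : MemLp φ 2 (space Ω) := hφ.continuous.memLp_of_hasCompactSupport hc
  have hdφ : Continuous fun x => fderiv ℝ φ x (EuclideanSpace.single i 1) :=
    (hφ.continuous_fderiv (by simp)).clm_apply continuous_const
  have hdc : HasCompactSupport fun x => fderiv ℝ φ x (EuclideanSpace.single i 1) :=
    hc.fderiv_apply ℝ _
  have hd2 : MemLp (fun x => fderiv ℝ φ x (EuclideanSpace.single i 1)) 2 (space Ω) :=
    hdφ.memLp_of_hasCompactSupport hdc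
  have e₁ := h₁.2.2 φ hφ hc hs i
  have e₂ := h₂.2.2 φ hφ hc hs i
  have i₁ : Integrable (fun x => f₁ x * fderiv ℝ φ x (EuclideanSpace.single i 1)) (space Ω) :=
    h₁.1.integrable_mul hd2
  have i₂ : Integrable (fun x => f₂ x * fderiv ℝ φ x (EuclideanSpace.single i 1)) (space Ω) :=
    h₂.1.integrable_mul hd2
  have j₁ : Integrable (fun x => F₁ x i * φ x) (space Ω) := (h₁.2.1.eval_piLp i).integrable_mul hφ2
  have j₂ : Integrable (fun x => F₂ x i * φ x) (space Ω) := (h₂.2.1.eval_piLp i).integrable_mul hφ2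
  simp only [Pi.sub_apply, PiLp.sub_apply, sub_mul]
  rw [integral_sub i₁ i₂, integral_sub j₁ j₂, e₁, e₂]
  ring

theorem IsL2H1.sub {Ω : Set (E N)} {T : ℝ} [IsFiniteMeasure (space Ω)] {w₁ w₂ : E N × ℝ → ℝ}
    {W₁ W₂ : E N × ℝ → E N} (h₁ : IsL2H1 Ω T w₁ W₁) (h₂ : IsL2H1 Ω T w₂ W₂) :
    IsL2H1 Ω T (w₁ - w₂) (W₁ - W₂) := by
  refine ⟨h₁.1.sub h₂.1, h₁.2.1.sub h₂.2.1, ?_⟩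
  filter_upwards [h₁.ae_isH1, h₂.ae_isH1] with t k₁ k₂
  exact HasWeakGrad.sub k₁ k₂

theorem HasTimeDeriv.sub {Ω : Set (E N)} {T : ℝ} [IsFiniteMeasure (space Ω)]
    {y₁ y₂ f₁ f₂ : E N × ℝ → ℝ} {F₁ F₂ : E N × ℝ → E N} (hy₁ : MemLp y₁ 2 (cyl Ω T))
    (hy₂ : MemLp y₂ 2 (cyl Ω T)) (h₁ : HasTimeDeriv Ω T y₁ f₁ F₁)
    (h₂ : HasTimeDeriv Ω T y₂ f₂ F₂) : HasTimeDeriv Ω T (y₁ - y₂) (f₁ - f₂) (F₁ - F₂) := by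
  refine ⟨h₁.1.sub h₂.1, h₁.2.1.sub h₂.2.1, fun φ hφ hc hs h H hh => ?_⟩
  have hbd : ∀ ψ : ℝ → ℝ, Continuous ψ → HasCompactSupport ψ → ∀ f : E N × ℝ → ℝ,
      Integrable f (cyl Ω T) → Integrable (fun z => f z * ψ z.2) (cyl Ω T) := by
    intro ψ hψ hc f hf
    obtain ⟨C, hC⟩ := hψ.bounded_above_of_compact_support hc
    exact hf.mul_bdd (hψ.comp continuous_snd).aestronglyMeasurable (ae_of_all _ fun z => hC z.2)
  have hi : ∀ y, MemLp y 2 (cyl Ω T) →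
      Integrable (fun z => y z * deriv φ z.2 * h z.1) (cyl Ω T) := fun y hy => by
    have hyh : Integrable (fun z : E N × ℝ => y z * h z.1) (cyl Ω T) :=
      hy.integrable_mul (hh.1.comp_fst (time T))
    refine (hbd _ (hφ.continuous_deriv (by simp)) hc.deriv _ hyh).congr (ae_of_all _ fun z => ?_)
    simp only
    ring
  have hj : ∀ (f : E N × ℝ → ℝ) (F : E N × ℝ → E N), MemLp f 2 (cyl Ω T) → MemLp F 2 (cyl Ω T) →
      Integrable (fun z => (f z * h z.1 + inner ℝ (F z) (H z.1)) * φ z.2) (cyl Ω T) :=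
    fun f F hf hF => hbd _ hφ.continuous hc _
      ((hf.integrable_mul (hh.1.comp_fst (time T))).add
        (integrable_inner_of_memLp hF (hh.2.1.comp_fst (time T))))
  have e₁ := h₁.2.2 φ hφ hc hs h H hh
  have e₂ := h₂.2.2 φ hφ hc hs h H hh
  have l : ∀ z : E N × ℝ, (y₁ - y₂) z * deriv φ z.2 * h z.1
      = y₁ z * deriv φ z.2 * h z.1 - y₂ z * deriv φ z.2 * h z.1 := fun z => by
    simp only [Pi.sub_apply]; ring
  have r : ∀ z : E N × ℝ, ((f₁ - f₂) z * h z.1 + inner ℝ ((F₁ - F₂) z) (H z.1)) * φ z.2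
      = (f₁ z * h z.1 + inner ℝ (F₁ z) (H z.1)) * φ z.2
        - (f₂ z * h z.1 + inner ℝ (F₂ z) (H z.1)) * φ z.2 := fun z => by
    simp only [Pi.sub_apply, inner_sub_left]; ring
  simp only [l, r]
  rw [integral_sub (hi _ hy₁) (hi _ hy₂), integral_sub (hj _ _ h₁.1 h₁.2.1) (hj _ _ h₂.1 h₂.2.1),
    ← e₁, ← e₂]
  ring

/-- The variational inequalities for two controls `u`, `w` with adjoints `p`, `q`, tested with one
another. -/
theorem mul_integral_sq_le_of_variational {X : Type*} [MeasurableSpace X] {μ : Measure X}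
    {p q u w : X → ℝ} {α : ℝ} (hu : MemLp u 2 μ) (hw : MemLp w 2 μ)
    (hp : Integrable (fun x => p x * (w x - u x)) μ)
    (hq : Integrable (fun x => q x * (w x - u x)) μ)
    (h₁ : 0 ≤ ∫ x, (p x + α * u x) * (w x - u x) ∂μ)
    (h₂ : 0 ≤ ∫ x, (q x + α * w x) * (u x - w x) ∂μ) :
    α * (eLpNorm (u - w) 2 μ).toReal ^ 2
      ≤ ∫ x, p x * (w x - u x) ∂μ - ∫ x, q x * (w x - u x) ∂μ := by
  have hd : MemLp (u - w) 2 μ := hu.sub hw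
  have hnorm : (eLpNorm (u - w) 2 μ).toReal ^ 2 = ∫ x, (u x - w x) * (u x - w x) ∂μ := by
    rw [← Lp.norm_toLp _ hd, ← real_inner_self_eq_norm_sq, L2.inner_def]
    refine integral_congr_ae ?_
    filter_upwards [hd.coeFn_toLp] with x hx
    rw [hx]
    rfl
  have iu : Integrable (fun x => u x * (w x - u x)) μ := hu.integrable_mul (hw.sub hu)
  have iw : Integrable (fun x => w x * (w x - u x)) μ := hw.integrable_mul (hw.sub hu)
  have e₁ : ∫ x, (p x + α * u x) * (w x - u x) ∂μ
      = ∫ x, p x * (w x - u x) ∂μ + α * ∫ x, u x * (w x - u x) ∂μ := by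
    rw [← integral_const_mul, ← integral_add hp (iu.const_mul α)]
    exact integral_congr_ae (ae_of_all _ fun x => by ring)
  have e₂ : ∫ x, (q x + α * w x) * (u x - w x) ∂μ
      = - (∫ x, q x * (w x - u x) ∂μ + α * ∫ x, w x * (w x - u x) ∂μ) := by
    rw [← integral_const_mul, ← integral_add hq (iw.const_mul α), ← integral_neg]
    exact integral_congr_ae (ae_of_all _ fun x => by ring)
  have e₃ : ∫ x, (u x - w x) * (u x - w x) ∂μ
      = ∫ x, w x * (w x - u x) ∂μ - ∫ x, u x * (w x - u x) ∂μ := by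
    rw [← integral_sub iw iu]
    exact integral_congr_ae (ae_of_all _ fun x => by ring)
  rw [hnorm, e₃]
  rw [e₁] at h₁
  rw [e₂] at h₂
  linarith

namespace Problem

variable (D : Problem N)

theorem two_le_dim (D : Problem N) : (2 : ℝ≥0∞) ≤ N := by
  rcases D.dim with h | h <;> rw [h] <;> norm_num

/-- Because N ≥ 2, the threshold N/2 + 1 is at least 2; on a finite measure the distributed controls
are then square integrable. -/
theorem two_le_r : 2 ≤ D.r := by
  refine le_trans ?_ D.r_gt.le
  calc (2 : ℝ≥0∞) = 2 / 2 + 1 := by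
        rw [ENNReal.div_self (by simp) (by simp)]; norm_num
    _ ≤ N / 2 + 1 := by gcongr; exact D.two_le_dim

theorem two_le_s : 2 ≤ D.s :=
  D.two_le_dim.trans (le_self_add.trans D.s_gt.le)

theorem memLp_cyl_of_continuousOn {f : E N × ℝ → ℝ}
    (hf : ContinuousOn f (closure D.Ω ×ˢ Icc 0 D.T)) : MemLp f 2 (cyl D.Ω D.T) := by
  obtain ⟨C, hC⟩ :=
    (D.isBounded.isCompact_closure.prod isCompact_Icc).exists_bound_of_continuousOn hf
  have hsub : D.Ω ×ˢ Ioo 0 D.T ⊆ closure D.Ω ×ˢ Icc 0 D.T :=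
    prod_mono subset_closure Ioo_subset_Icc_self
  have hm : MeasurableSet (D.Ω ×ˢ Ioo 0 D.T) := D.isOpen.measurableSet.prod measurableSet_Ioo
  have hc : cyl D.Ω D.T = (volume.prod volume).restrict (D.Ω ×ˢ Ioo 0 D.T) :=
    Measure.prod_restrict _ _
  refine MemLp.of_bound ?_ C ?_
  · rw [hc]; exact (hf.mono hsub).aestronglyMeasurable hm
  · rw [hc]; filter_upwards [ae_restrict_mem hm] with z hz using hC z (hsub hz)

theorem memLp_slice_of_continuousOn {f : E N × ℝ → ℝ}
    (hf : ContinuousOn f (closure D.Ω ×ˢ Icc 0 D.T)) {t : ℝ} (ht : t ∈ Icc 0 D.T) :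
    MemLp (fun x => f (x, t)) 2 (space D.Ω) := by
  obtain ⟨C, hC⟩ :=
    (D.isBounded.isCompact_closure.prod isCompact_Icc).exists_bound_of_continuousOn hf
  refine MemLp.of_bound ?_ C ?_
  · refine ContinuousOn.aestronglyMeasurable ?_ D.isOpen.measurableSet
    exact hf.comp (by fun_prop) fun x hx => ⟨subset_closure hx, ht⟩
  · filter_upwards [ae_restrict_mem D.isOpen.measurableSet] with x hx
    exact hC _ ⟨subset_closure hx, ht⟩

theorem integrable_of_continuousOn {f : E N × ℝ → ℝ}
    (hf : ContinuousOn f (closure D.Ω ×ˢ Icc 0 D.T)) {μ : Measure (E N × ℝ)} [IsFiniteMeasure μ]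
    (hμ : μ (closure D.Ω ×ˢ Icc 0 D.T)ᶜ = 0) : Integrable f μ := by
  have h := hf.integrableOn_compact (μ := μ) (D.isBounded.isCompact_closure.prod isCompact_Icc)
  rwa [IntegrableOn, Measure.restrict_eq_self_of_ae_mem (s := closure D.Ω ×ˢ Icc 0 D.T) (mem_ae_iff.2 hμ)] at h

theorem integrable_form {G W : E N × ℝ → E N} (hG : MemLp G 2 (cyl D.Ω D.T))
    (hW : MemLp W 2 (cyl D.Ω D.T)) :
    Integrable (fun z => ∑ i, ∑ j, D.a i j z.1 * G z i * W z j) (cyl D.Ω D.T) := by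
  refine integrable_finsetSum _ fun i _ => integrable_finsetSum _ fun j _ => ?_
  have ha : MemLp (fun z : E N × ℝ => D.a i j z.1) ∞ (cyl D.Ω D.T) :=
    (D.a_mem i j).comp_fst (time D.T)
  have h : MemLp (fun z => D.a i j z.1 * G z i) 2 (cyl D.Ω D.T) := (hG.eval_piLp i).mul ha
  exact h.integrable_mul (hW.eval_piLp j)

/-- Symmetry of the coefficients makes A formally self-adjoint, so the elliptic terms of the state
and adjoint equations cancel. -/
theorem integral_form_symm (G W : E N × ℝ → E N) :
    ∫ z, ∑ i, ∑ j, D.a i j z.1 * G z i * W z j ∂(cyl D.Ω D.T)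
      = ∫ z, ∑ i, ∑ j, D.a i j z.1 * W z i * G z j ∂(cyl D.Ω D.T) := by
  have hs : ∀ᵐ z ∂(cyl D.Ω D.T), ∀ i j, D.a i j z.1 = D.a j i z.1 := by
    refine Measure.quasiMeasurePreserving_fst.ae (μb := space D.Ω)
      (p := fun x => ∀ i j, D.a i j x = D.a j i x) ?_
    exact ae_all_iff.2 fun i => ae_all_iff.2 fun j => D.a_symm i j
  refine integral_congr_ae ?_
  filter_upwards [hs] with z hz
  rw [Finset.sum_comm]
  refine Finset.sum_congr rfl fun i _ => Finset.sum_congr rfl fun j _ => ?_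
  rw [hz j i]
  ring

variable {D}

theorem IsState.sub {y₁ y₂ f₁ f₂ g₁ g₂ : E N × ℝ → ℝ} {η : E N → ℝ} (h₁ : D.IsState y₁ f₁ g₁ η)
    (h₂ : D.IsState y₂ f₂ g₂ η) (hf₁ : MemLp f₁ 2 (cyl D.Ω D.T)) (hf₂ : MemLp f₂ 2 (cyl D.Ω D.T))
    (hg₁ : MemLp g₁ 2 (lat D.Ω D.T)) (hg₂ : MemLp g₂ 2 (lat D.Ω D.T)) :
    D.IsState (y₁ - y₂) (f₁ - f₂) (g₁ - g₂) 0 := by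
  obtain ⟨hc₁, hi₁, G₁, d₁, F₁, hL₁, hd₁, he₁⟩ := h₁
  obtain ⟨hc₂, hi₂, G₂, d₂, F₂, hL₂, hd₂, he₂⟩ := h₂
  refine ⟨hc₁.sub hc₂, fun x hx => ?_, G₁ - G₂, d₁ - d₂, F₁ - F₂, hL₁.sub hL₂,
    hd₁.sub hL₁.1 hL₂.1 hd₂, fun w W b hw hb hb2 => ?_⟩
  · simp [hi₁ x hx, hi₂ x hx]
  have e₁ := he₁ w W b hw hb hb2
  have e₂ := he₂ w W b hw hb hb2
  have it : ∀ {d F}, MemLp d 2 (cyl D.Ω D.T) → MemLp F 2 (cyl D.Ω D.T) →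
      Integrable (fun z => d z * w z + inner ℝ (F z) (W z)) (cyl D.Ω D.T) := fun hd hF =>
    (hd.integrable_mul hw.1).add (integrable_inner_of_memLp hF hw.2.1)
  have ig : ∀ {g}, MemLp g 2 (lat D.Ω D.T) → Integrable (fun z => g z * b z) (lat D.Ω D.T) :=
    fun hg => hg.integrable_mul hb2
  have ir : ∀ {f}, MemLp f 2 (cyl D.Ω D.T) → Integrable (fun z => f z * w z) (cyl D.Ω D.T) :=
    fun hf => hf.integrable_mul hw.1
  have s₁ : ∫ z, ((d₁ - d₂) z * w z + inner ℝ ((F₁ - F₂) z) (W z)) ∂(cyl D.Ω D.T)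
      = ∫ z, (d₁ z * w z + inner ℝ (F₁ z) (W z)) ∂(cyl D.Ω D.T)
        - ∫ z, (d₂ z * w z + inner ℝ (F₂ z) (W z)) ∂(cyl D.Ω D.T) := by
    rw [← integral_sub (it hd₁.1 hd₁.2.1) (it hd₂.1 hd₂.2.1)]
    refine integral_congr_ae (ae_of_all _ fun z => ?_)
    simp only [Pi.sub_apply, inner_sub_left]
    ring
  have s₂ : ∫ z, (g₁ - g₂) z * b z ∂(lat D.Ω D.T)
      = ∫ z, g₁ z * b z ∂(lat D.Ω D.T) - ∫ z, g₂ z * b z ∂(lat D.Ω D.T) := by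
    rw [← integral_sub (ig hg₁) (ig hg₂)]
    simp only [Pi.sub_apply, sub_mul]
  have s₃ : ∫ z, (f₁ - f₂) z * w z ∂(cyl D.Ω D.T)
      = ∫ z, f₁ z * w z ∂(cyl D.Ω D.T) - ∫ z, f₂ z * w z ∂(cyl D.Ω D.T) := by
    rw [← integral_sub (ir hf₁) (ir hf₂)]
    simp only [Pi.sub_apply, sub_mul]
  have s₄ : ∫ z, ∑ i, ∑ j, D.a i j z.1 * (G₁ - G₂) z i * W z j ∂(cyl D.Ω D.T)
      = ∫ z, ∑ i, ∑ j, D.a i j z.1 * G₁ z i * W z j ∂(cyl D.Ω D.T)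
        - ∫ z, ∑ i, ∑ j, D.a i j z.1 * G₂ z i * W z j ∂(cyl D.Ω D.T) := by
    rw [← integral_sub (D.integrable_form hL₁.2.1 hw.2.1) (D.integrable_form hL₂.2.1 hw.2.1)]
    simp only [Pi.sub_apply, PiLp.sub_apply, mul_sub, sub_mul, Finset.sum_sub_distrib]
  rw [s₁, s₂, s₃, s₄, ← e₁, ← e₂]
  ring

/-- Duality between a state with zero initial value and an adjoint state. -/
theorem IsState.integral_adjoint {z f h p m π : E N × ℝ → ℝ} {g : E N → ℝ}
    (hz : D.IsState z f h 0) (hp : D.IsAdjoint p m g) (hg : MemLp g 2 (space D.Ω))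
    (hπ : IsLatTrace D.Ω D.T 2 p π) (hπ2 : MemLp π 2 (lat D.Ω D.T)) :
    ∫ c, p c * f c ∂(cyl D.Ω D.T) + ∫ c, π c * h c ∂(lat D.Ω D.T)
      = ∫ c, m c * z c ∂(cyl D.Ω D.T) + ∫ x, g x * z (x, D.T) ∂(space D.Ω) := by
  obtain ⟨hzc, hz0, G, d, F, hL, hd, he⟩ := hz
  obtain ⟨hpT, G', d', F', hL', hd', he'⟩ := hp
  -- Test the state equation with p and the adjoint equation with z; only the two time derivative
  -- terms remain, and `e₃` evaluates their sum.
  have e₁ := he p G' π hL' hπ hπ2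
  have e₂ := he' z G hL
  have e₃ := integral_timeDeriv_add_integral_timeDeriv D.isOpen D.isBounded D.T_pos hL hzc hz0 hd
    hL' hd' hg hpT
  rw [D.integral_form_symm G G'] at e₁
  simp only [mul_comm (p _), mul_comm (π _)]
  linarith

end Problem

end ParabolicControl

/-! ### The error estimate -/

open ParabolicControl in
theorem lemma3p3 {N : ℕ} (D : ParabolicControl.Problem N)
    (y u v p π : ParabolicControl.E N × ℝ → ℝ) (μΩ μS : Measure (ParabolicControl.E N × ℝ))
    (hopt : D.OptimalitySystem y u v p π μΩ μS)
    (ρk : ℝ) (hρk : 0 < ρk) (μk : ParabolicControl.E N × ℝ → ℝ)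
    (hμk : MemLp μk 2 (ParabolicControl.cyl D.Ω D.T))
    (hμk_nonneg : ∀ᵐ z ∂(ParabolicControl.cyl D.Ω D.T), 0 ≤ μk z)
    (yk uk vk pk πk : ParabolicControl.E N × ℝ → ℝ)
    (haug : D.AugmentedSystem ρk μk yk uk vk pk πk) :
    D.α * (eLpNorm (u - uk) 2 (ParabolicControl.cyl D.Ω D.T)).toReal ^ 2
        + D.β * (eLpNorm (v - vk) 2 (ParabolicControl.lat D.Ω D.T)).toReal ^ 2
      ≤ ∫ z, D.multiplier ρk μk yk z * (D.ψ z - yk z) ∂(ParabolicControl.cyl D.Ω D.T)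
        + ∫ z, (yk z - D.ψ z) ∂(μΩ + μS) := by
  have := hopt.finΩ
  have := hopt.finS
  have hu : MemLp u 2 (cyl D.Ω D.T) := hopt.u_adm.1.mono_exponent D.two_le_r
  have huk : MemLp uk 2 (cyl D.Ω D.T) := haug.u_adm.1.mono_exponent D.two_le_r
  have hv : MemLp v 2 (lat D.Ω D.T) := hopt.v_adm.1.mono_exponent D.two_le_s
  have hvk : MemLp vk 2 (lat D.Ω D.T) := haug.v_adm.1.mono_exponent D.two_le_s
  have hyc := hopt.state.1
  have hykc := haug.state.1
  have hz : D.IsState (yk - y) (uk - u) (vk - v) 0 := haug.state.sub hopt.state huk hu hvk hv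
  have hT : D.T ∈ Icc 0 D.T := right_mem_Icc.2 D.T_pos.le
  have hyT := D.memLp_slice_of_continuousOn hyc hT
  have hykT := D.memLp_slice_of_continuousOn hykc hT
  have hpk2 : MemLp pk 2 (cyl D.Ω D.T) := by
    obtain ⟨-, G, d, F, hL, -⟩ := haug.adjoint
    exact hL.1
  -- The measure adjoint and its trace are only known in the dual spaces of the controls, so their
  -- products with control differences are integrable by Hölder, not by L² pairing.
  have hconjr : D.r.HolderConjugate D.r.conjExponent :=
    ENNReal.HolderConjugate.conjExponent ((by norm_num : (1 : ℝ≥0∞) ≤ 2).trans D.two_le_r)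
  have hconjs : D.s.HolderConjugate D.s.conjExponent :=
    ENNReal.HolderConjugate.conjExponent ((by norm_num : (1 : ℝ≥0∞) ≤ 2).trans D.two_le_s)
  have hconjr' := hconjr.symm
  have hconjs' := hconjs.symm
  have hV₁ := mul_integral_sq_le_of_variational hu huk
    (hopt.adjoint.2.1.integrable_mul (haug.u_adm.1.sub hopt.u_adm.1))
    (hpk2.integrable_mul (huk.sub hu)) (hopt.var_u _ haug.u_adm) (haug.var_u _ hopt.u_adm)
  have hV₂ := mul_integral_sq_le_of_variational hv hvk
    (hopt.adjoint.2.2.1.integrable_mul (haug.v_adm.1.sub hopt.v_adm.1))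
    (haug.trace.2.integrable_mul (hvk.sub hv)) (hopt.var_v _ haug.v_adm) (haug.var_v _ hopt.v_adm)
  have e₁ := hopt.adjoint.2.2.2 _ _ _ (haug.u_adm.1.sub hopt.u_adm.1)
    (haug.v_adm.1.sub hopt.v_adm.1) hz
  have e₂ := hz.integral_adjoint haug.adjoint (hykT.sub D.yd_mem) haug.trace.1 haug.trace.2
  simp only [Pi.sub_apply] at e₁ e₂
  -- The multipliers live on the compact closed cylinder, where continuous functions are bounded and
  -- hence integrable.
  have hsubΩ : μΩ (closure D.Ω ×ˢ Icc 0 D.T)ᶜ = 0 := measure_mono_null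
    (compl_subset_compl.2 (prod_mono subset_closure Ioo_subset_Icc_self)) hopt.concΩ
  have hsubS : μS (closure D.Ω ×ˢ Icc 0 D.T)ᶜ = 0 := measure_mono_null
    (compl_subset_compl.2 (prod_mono frontier_subset_closure Ioo_subset_Icc_self)) hopt.concS
  have hsub : (μΩ + μS) (closure D.Ω ×ˢ Icc 0 D.T)ᶜ = 0 := by simp [hsubΩ, hsubS]
  have e₃ : ∫ z, (yk z - y z) ∂μΩ + ∫ z, (yk z - y z) ∂μS = ∫ z, (yk z - D.ψ z) ∂(μΩ + μS) := by
    have hi : ContinuousOn (fun z => yk z - y z) _ := hykc.sub hyc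
    rw [← integral_add_measure (D.integrable_of_continuousOn hi hsubΩ)
      (D.integrable_of_continuousOn hi hsubS)]
    have j₁ : Integrable (fun z => yk z - D.ψ z) (μΩ + μS) :=
      D.integrable_of_continuousOn (hykc.sub D.ψ_cont) hsub
    have j₂ : Integrable (fun z => y z - D.ψ z) (μΩ + μS) :=
      D.integrable_of_continuousOn (hyc.sub D.ψ_cont) hsub
    rw [← sub_zero (∫ z, (yk z - D.ψ z) ∂(μΩ + μS)), ← hopt.compl, ← integral_sub j₁ j₂]
    exact integral_congr_ae (ae_of_all _ fun z => by ring)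
  have hm : MemLp (D.multiplier ρk μk yk) 2 (cyl D.Ω D.T) :=
    (((D.memLp_cyl_of_continuousOn (hykc.sub D.ψ_cont)).const_mul ρk).add hμk).pos_part
  have i₁ : Integrable (fun z => D.multiplier ρk μk yk z * (D.ψ z - yk z)) (cyl D.Ω D.T) :=
    hm.integrable_mul (D.memLp_cyl_of_continuousOn (D.ψ_cont.sub hykc))
  have i₂ : Integrable (fun z => D.multiplier ρk μk yk z * (yk z - y z)) (cyl D.Ω D.T) :=
    hm.integrable_mul (D.memLp_cyl_of_continuousOn (hykc.sub hyc))
  -- The two integrands add up to m (ψ - y), nonnegative by feasibility of y; feasibility of yk is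
  -- not needed.
  have e₄ : 0 ≤ ∫ z, D.multiplier ρk μk yk z * (D.ψ z - yk z) ∂(cyl D.Ω D.T)
      + ∫ z, D.multiplier ρk μk yk z * (yk z - y z) ∂(cyl D.Ω D.T) := by
    rw [← integral_add i₁ i₂]
    refine integral_nonneg_of_ae ?_
    have hmem : ∀ᵐ z ∂(cyl D.Ω D.T), z ∈ D.Ω ×ˢ Ioo 0 D.T := by
      rw [show cyl D.Ω D.T = (volume.prod volume).restrict (D.Ω ×ˢ Ioo 0 D.T) from
        Measure.prod_restrict _ _]
      exact ae_restrict_mem (D.isOpen.measurableSet.prod measurableSet_Ioo)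
    filter_upwards [hmem] with z hz
    have h1 : y z ≤ D.ψ z := hopt.feasible z.1 hz.1 z.2 hz.2
    have h2 : 0 ≤ D.multiplier ρk μk yk z := le_max_right _ _
    have h3 := mul_nonneg h2 (sub_nonneg.2 h1)
    simp only [Pi.zero_apply]
    linarith
  -- The two sides differ by ‖yk(T) - y(T)‖², which the estimate discards.
  have e₅ : ∫ x, (y (x, D.T) - D.yd x) * (yk (x, D.T) - y (x, D.T)) ∂(space D.Ω)
      ≤ ∫ x, (yk (x, D.T) - D.yd x) * (yk (x, D.T) - y (x, D.T)) ∂(space D.Ω) := by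
    refine integral_mono ((hyT.sub D.yd_mem).integrable_mul (hykT.sub hyT))
      ((hykT.sub D.yd_mem).integrable_mul (hykT.sub hyT)) fun x => ?_
    change (y (x, D.T) - D.yd x) * (yk (x, D.T) - y (x, D.T))
      ≤ (yk (x, D.T) - D.yd x) * (yk (x, D.T) - y (x, D.T))
    nlinarith [sq_nonneg (yk (x, D.T) - y (x, D.T))]
  linarith
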